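/- Let $H$ be a discrete Schrödinger operator $$[H\psi](n)=\psi(n+1)+\psi(n-1)+V(n)\psi(n)$$ with a real potential $V$, acting on $\ell^2(\mathbb Z)$ or on $\ell^2(\mathbb Z_+)$, $\mathbb Z_+=\{1,2,\dots\}$, in the latter case with the Dirichlet boundary condition $\psi(0)=0$ (if $V$ is unbounded, $H$ is taken on its maximal domain, where it is self-adjoint). Let $\mu$ be the spectral measure of $H$ and $\delta_1$, and let $$F(z)=\langle (H-z)^{-1}\delta_1,\delta_1\rangle=\int_{\mathbb R}\frac{d\mu(x)}{x-z}$$ be its Borel transform. For $T>0$ and $p>0$ put $$a(n,T)=\frac2T\int_0^\infty e^{-2t/T}\,|\langle e^{-itH}\delta_1,\delta_n\rangle|^2\,dt,\qquad \langle|X|^p_{\delta_1}\rangle(T)=\sum_n|n|^p\,a(n,T),$$ and for $\Delta\subseteq\mathbb R$ and $\nu>0$ put $$I(\Delta,\nu)=\nu\int_\Delta(\operatorname{Im}F(E+i\nu))^2\,dE,\qquad \Delta_\nu=\{E\in\mathbb R:\operatorname{dist}(E,\Delta)<\nu\}.$$ **Theorem.** Let $p>0$. There is a constant $C_p>0$,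 depending only on $p$, such that the following holds for every such operator $H$. Let $A=A(T)\subseteq\mathbb R$ be Borel sets, possibly depending on $T$, and let $g_p(T)$ be a function of $T$. For every $T>0$ with $\mu(A)>0$, $g_p(T)>0$ and $$\langle|X|^p_{\delta_1}\rangle(T)\ \ge\ g_p(T)\,I(A_{2\varepsilon},\varepsilon),\qquad \varepsilon=\frac1T,$$ one has $$\langle|X|^p_{\delta_1}\rangle(T)\ \ge\ C_p\,g_p(T)^{p/(p+1)}\,\mu(A)^{(1+2p)/(p+1)}.$$ In particular, if the Borel set $A$ does not depend on $T$ and $\mu(A)>0$, then there is a constant $C>0$, independent of $T$ and of $g_p$ (but depending on $p$, $H$ and $A$), such that for every $T>0$ for which $g_p(T)>0$ and the above hypothesis holds, $$\langle|X|^p_{\delta_1}\rangle(T)\ \ge\ C\,g_p(T)^{p/(p+1)}.$$ -/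

import Mathlib

open MeasureTheory Filter Topology

namespace Schrodinger

/-- The two configuration spaces: the whole line `ℤ` and the half-line `{1, 2, …}`. -/
inductive Domain
  | wholeLine
  | halfLine

/-- The set of sites, as a subset of `ℤ`. -/
def Domain.sites : Domain → Set ℤ
  | .wholeLine => Set.univ
  | .halfLine => Set.Ici 1

theorem Domain.one_mem (d : Domain) : (1 : ℤ) ∈ d.sites := by
  cases d <;> simp [Domain.sites]

/-- The site `1`. -/
def Domain.one (d : Domain) : d.sites := ⟨1, d.one_mem⟩

noncomputable section

/-- The Hilbert space `ℓ²` over the sites. -/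
abbrev Domain.ell2 (d : Domain) := lp (fun _ : d.sites => ℂ) 2

/-- The unit vector `δ₁`. -/
def delta (d : Domain) : d.ell2 := lp.single 2 d.one 1

open Classical in
/-- The value of `f` at an integer, with the value `0` off the sites. On the half-line this is the
Dirichlet boundary condition. -/
def zeroExt {d : Domain} (f : d.sites → ℂ) (n : ℤ) : ℂ := if h : n ∈ d.sites then f ⟨n, h⟩ else 0

/-- The difference expression `f(n + 1) + f(n - 1) + V(n) f(n)`. -/
def expr {d : Domain} (V : d.sites → ℝ) (f : d.sites → ℂ) : d.sites → ℂ :=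
  fun n => zeroExt f (n + 1) + zeroExt f (n - 1) + (V n : ℂ) * f n

theorem zeroExt_add {d : Domain} (f g : d.sites → ℂ) (n : ℤ) :
    zeroExt (f + g) n = zeroExt f n + zeroExt g n := by
  unfold zeroExt; split_ifs <;> simp

theorem zeroExt_smul {d : Domain} (c : ℂ) (f : d.sites → ℂ) (n : ℤ) :
    zeroExt (c • f) n = c * zeroExt f n := by
  unfold zeroExt; split_ifs <;> simp

theorem expr_add {d : Domain} (V : d.sites → ℝ) (f g : d.sites → ℂ) :
    expr V (f + g) = expr V f + expr V g := by
  ext n; simp only [expr, zeroExt_add, Pi.add_apply]; ring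

theorem expr_smul {d : Domain} (V : d.sites → ℝ) (c : ℂ) (f : d.sites → ℂ) :
    expr V (c • f) = c • expr V f := by
  ext n; simp only [expr, zeroExt_smul, Pi.smul_apply, smul_eq_mul]; ring

/-- The discrete Schrödinger operator `H` with potential `V`, on its maximal domain
`{ψ ∈ ℓ² | Hψ ∈ ℓ²}` (all of `ℓ²` if `V` is bounded), where it is self-adjoint for every real
potential. -/
def hamiltonian {d : Domain} (V : d.sites → ℝ) : d.ell2 →ₗ.[ℂ] d.ell2 where
  domain :=
    { carrier := {ψ | Memℓp (expr V ψ) 2}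
      add_mem' := by
        intro a b ha hb
        simp only [Set.mem_ofPred_eq, lp.coeFn_add, expr_add] at *
        exact ha.add hb
      zero_mem' := by
        have : expr V (0 : d.sites → ℂ) = 0 := by
          simpa using expr_smul V 0 (0 : d.sites → ℂ)
        simp only [Set.mem_ofPred_eq, lp.coeFn_zero, this]
        exact zero_memℓp
      smul_mem' := by
        intro c a ha
        simp only [Set.mem_ofPred_eq, lp.coeFn_smul, expr_smul] at *
        exact ha.const_smul c }
  toFun :=
    { toFun := fun ψ => ⟨expr V ψ.1, ψ.2⟩
      map_add' := by
        intro a b; ext n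
        exact congrFun (expr_add V a.1 b.1) n
      map_smul' := by
        intro c a; ext n
        exact congrFun (expr_smul V c a.1) n }

theorem mem_domain_iff {d : Domain} {V : d.sites → ℝ} {ψ : d.ell2} :
    ψ ∈ (hamiltonian V).domain ↔ Memℓp (expr V ψ) 2 := Iff.rfl

theorem hamiltonian_apply {d : Domain} (V : d.sites → ℝ) (ψ : (hamiltonian V).domain)
    (n : d.sites) : (hamiltonian V ψ : d.ell2) n = expr V (ψ : d.ell2) n := rfl

theorem zeroExt_coe {d : Domain} (f : d.sites → ℂ) (n : d.sites) : zeroExt f n = f n := by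
  simp [zeroExt]

theorem zeroExt_of_notMem {d : Domain} (f : d.sites → ℂ) {n : ℤ} (h : n ∉ d.sites) :
    zeroExt f n = 0 := by
  simp [zeroExt, h]

theorem summable_zeroExt_sq {d : Domain} (f : d.ell2) :
    Summable fun n : ℤ => ‖zeroExt f n‖ ^ 2 := by
  have h1 : Summable fun n : d.sites => ‖f n‖ ^ 2 := by
    simpa using (lp.memℓp f).summable (by simp)
  have h2 : (fun n : d.sites => ‖f n‖ ^ 2) =
      (fun n : ℤ => ‖zeroExt f n‖ ^ 2) ∘ ((↑) : d.sites → ℤ) := by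
    ext n; simp [zeroExt_coe]
  rw [h2] at h1
  have hsupp : Function.support (fun n : ℤ => ‖zeroExt f n‖ ^ 2) ⊆ d.sites := ?_
  · exact ((hasSum_subtype_iff_of_support_subset hsupp).1 h1.hasSum).summable
  intro n hn
  by_contra h
  exact hn (by simp [zeroExt_of_notMem _ h])

theorem summable_star_mul {a b : ℤ → ℂ} (ha : Summable fun n => ‖a n‖ ^ 2)
    (hb : Summable fun n => ‖b n‖ ^ 2) : Summable fun n => star (a n) * b n := by
  have hab : Summable fun n => ‖a n‖ ^ 2 + ‖b n‖ ^ 2 := ha.add hb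
  refine Summable.of_norm_bounded (g := fun n => ‖a n‖ ^ 2 + ‖b n‖ ^ 2) hab fun n => ?_
  rw [norm_mul, norm_star]
  nlinarith [sq_nonneg (‖a n‖ - ‖b n‖), sq_nonneg (‖a n‖), sq_nonneg (‖b n‖)]

theorem hasSum_telescope {w : ℤ → ℂ} (hw : Summable w) :
    HasSum (fun n => w n - w (n - 1)) 0 := by
  have h2 : HasSum (w ∘ Equiv.subRight (1 : ℤ)) (∑' n, w n) :=
    (Equiv.subRight (1 : ℤ)).hasSum_iff.2 hw.hasSum
  have h3 := hw.hasSum.sub h2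
  rw [sub_self] at h3
  exact h3

/-- The operator is symmetric on its maximal domain. -/
theorem hamiltonian_symm {d : Domain} (V : d.sites → ℝ) (φ ψ : (hamiltonian V).domain) :
    inner ℂ (hamiltonian V φ) (ψ : d.ell2) = inner ℂ (φ : d.ell2) (hamiltonian V ψ) := by
  have hs := (lp.hasSum_inner (𝕜 := ℂ) (hamiltonian V φ) (ψ : d.ell2)).sub
    (lp.hasSum_inner (𝕜 := ℂ) (φ : d.ell2) (hamiltonian V ψ))
  set f : ℤ → ℂ := zeroExt (φ : d.ell2) with hf
  set g : ℤ → ℂ := zeroExt (ψ : d.ell2) with hg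
  let w : ℤ → ℂ := fun n => star (f (n + 1)) * g n - star (f n) * g (n + 1)
  have sf := summable_zeroExt_sq (φ : d.ell2)
  have sg := summable_zeroExt_sq (ψ : d.ell2)
  have sf' := (Equiv.addRight (1 : ℤ)).summable_iff.2 sf
  have sg' := (Equiv.addRight (1 : ℤ)).summable_iff.2 sg
  have hw : Summable w := (summable_star_mul sf' sg).sub (summable_star_mul sf sg')
  have hw1 := hasSum_telescope hw
  have hw2 : HasSum ((fun n => w n - w (n - 1)) ∘ ((↑) : d.sites → ℤ)) 0 := by
    have hsupp : Function.support (fun n => w n - w (n - 1)) ⊆ d.sites := ?_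
    · exact (hasSum_subtype_iff_of_support_subset hsupp).2 hw1
    intro n hn
    by_contra h
    have h1 : f n = 0 := zeroExt_of_notMem _ h
    have h2 : g n = 0 := zeroExt_of_notMem _ h
    exact hn (by simp [w, h1, h2])
  have e : (fun n : d.sites => inner ℂ ((hamiltonian V φ : d.ell2) n) ((ψ : d.ell2) n) -
      inner ℂ ((φ : d.ell2) n) ((hamiltonian V ψ : d.ell2) n)) =
      (fun n => w n - w (n - 1)) ∘ ((↑) : d.sites → ℤ) := by
    ext n
    have h1 : f n = (φ : d.ell2) n := zeroExt_coe _ n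
    have h2 : g n = (ψ : d.ell2) n := zeroExt_coe _ n
    simp only [hamiltonian_apply, expr, RCLike.inner_apply, Function.comp, w, ← hf, ← hg, ← h1,
      ← h2, map_add, map_mul, Complex.conj_ofReal, RCLike.star_def, sub_add_cancel]
    ring
  rw [e] at hs
  exact sub_eq_zero.1 (hs.unique hw2)

/-- `ψ` solves the Schrödinger equation `i ψ' = H ψ` with `ψ(0) = δ₁`, that is,
`ψ(t) = e^{-itH} δ₁`. -/
def IsEvolution {d : Domain} (V : d.sites → ℝ) (ψ : ℝ → d.ell2) : Prop :=
  ψ 0 = delta d ∧ ∀ t : ℝ, ∃ h : ψ t ∈ (hamiltonian V).domain,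
    HasDerivAt ψ (-Complex.I • hamiltonian V ⟨ψ t, h⟩) t

theorem IsEvolution.unique {d : Domain} {V : d.sites → ℝ} {ψ χ : ℝ → d.ell2}
    (hψ : IsEvolution V ψ) (hχ : IsEvolution V χ) : ψ = χ := by
  have hder : ∀ t, HasDerivAt (fun t => inner ℂ (ψ t - χ t) (ψ t - χ t)) 0 t := by
    intro t
    obtain ⟨h1, d1⟩ := hψ.2 t
    obtain ⟨h2, d2⟩ := hχ.2 t
    have hd : HasDerivAt (fun t => ψ t - χ t) _ t := d1.sub d2
    have h := hd.inner ℂ hd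
    refine h.congr_deriv ?_
    have e : -Complex.I • hamiltonian V ⟨ψ t, h1⟩ - -Complex.I • hamiltonian V ⟨χ t, h2⟩ =
        -Complex.I • hamiltonian V (⟨ψ t, h1⟩ - ⟨χ t, h2⟩) := by
      rw [(hamiltonian V).map_sub, smul_sub]
    have s := hamiltonian_symm V (⟨ψ t, h1⟩ - ⟨χ t, h2⟩) (⟨ψ t, h1⟩ - ⟨χ t, h2⟩)
    rw [e, inner_smul_left, inner_smul_right]
    simp only [AddSubgroupClass.coe_sub] at s ⊢
    rw [s]
    simp only [map_neg, Complex.conj_I]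
    ring
  funext t
  have hc := is_const_of_deriv_eq_zero (fun t => (hder t).differentiableAt)
    (fun t => (hder t).deriv) t 0
  simp only [hψ.1, hχ.1, sub_self, inner_zero_left] at hc
  exact sub_eq_zero.1 (inner_self_eq_zero.1 hc)

/-- Spectral resolution of a Hermitian matrix at a basis vector: `U h = h(A) e_o`. -/
theorem finite_spectral {ι : Type*} [Fintype ι] [DecidableEq ι] (A : Matrix ι ι ℂ)
    (hA : A.IsHermitian) (o : ι) :
    ∃ (ν : Measure ℝ) (U : (ℝ → ℂ) →ₗ[ℂ] (ι → ℂ)), IsProbabilityMeasure ν ∧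
      U 1 = Pi.single o 1 ∧ (∀ h, A.mulVec (U h) = U (fun x => (x : ℂ) * h x)) ∧
      (∀ h, ∑ n, ‖U h n‖ ^ 2 = ∫ x, ‖h x‖ ^ 2 ∂ν) ∧ (∀ h, U h o = ∫ x, h x ∂ν) ∧
      (∀ h : ℝ → ℝ, Integrable h ν) := by
  set b := hA.eigenvectorBasis with hb
  set lam := hA.eigenvalues with hlam
  let e : EuclideanSpace ℂ ι := EuclideanSpace.single o 1
  have hbo : ∀ k, inner ℂ (b k) e = star (b k o) := by
    intro k; simp [e, EuclideanSpace.inner_single_right]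
  have hsum : ∑ k, ‖inner ℂ (b k) e‖ ^ 2 = 1 := by
    rw [b.sum_sq_norm_inner_right]; simp [e]
  let U : (ℝ → ℂ) →ₗ[ℂ] (ι → ℂ) :=
    { toFun := fun h n => ∑ k, (h (lam k) * inner ℂ (b k) e) * b k n
      map_add' := by
        intro h g; ext n; simp [add_mul, Finset.sum_add_distrib]
      map_smul' := by
        intro c h; ext n; simp [Finset.mul_sum, mul_assoc] }
  have hU : ∀ h n, U h n = ∑ k, (h (lam k) * inner ℂ (b k) e) * b k n := fun _ _ => rfl
  have hUv : ∀ h, WithLp.toLp 2 (U h) = b.repr.symm (WithLp.toLp 2 fun k => h (lam k) * inner ℂ (b k) e) := by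
    intro h
    rw [← OrthonormalBasis.sum_repr_symm]
    ext n
    simp [hU]
  let ν : Measure ℝ := ∑ k, ENNReal.ofReal (‖inner ℂ (b k) e‖ ^ 2) • Measure.dirac (lam k)
  have hint : ∀ {E : Type} [NormedAddCommGroup E] [NormedSpace ℝ E] (h : ℝ → E), Integrable h ν := by
    intro E _ _ h
    refine integrable_finsetSum_measure.2 fun k _ => ?_
    refine Integrable.smul_measure ?_ (by simp)
    exact integrable_dirac (by simp)
  have hνint : ∀ {E : Type} [NormedAddCommGroup E] [NormedSpace ℝ E] [CompleteSpace E] (h : ℝ → E),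
      ∫ x, h x ∂ν = ∑ k, ‖inner ℂ (b k) e‖ ^ 2 • h (lam k) := by
    intro E _ _ _ h
    rw [integral_finsetSum_measure]
    · refine Finset.sum_congr rfl fun k _ => ?_
      rw [integral_smul_measure, integral_dirac, ENNReal.toReal_ofReal (by positivity)]
    · exact fun k hk => integrable_finsetSum_measure.1 (hint h) k hk
  refine ⟨ν, U, ⟨?_⟩, ?_, ?_, ?_, ?_, fun h => hint h⟩
  · simp only [ν, Measure.coe_finsetSum, Finset.sum_apply, Measure.smul_apply, measure_univ,
      smul_eq_mul, mul_one]
    rw [← ENNReal.ofReal_sum_of_nonneg (fun _ _ => by positivity), hsum]; simp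
  · have : WithLp.toLp 2 (U 1) = e := by
      rw [hUv, LinearIsometryEquiv.symm_apply_eq]
      ext k
      simp [OrthonormalBasis.repr_apply_apply]
    have h2 := congrArg WithLp.ofLp this
    simpa [e] using h2
  · intro h
    have : U h = ∑ k, (h (lam k) * inner ℂ (b k) e) • (b k).ofLp := by
      ext n; simp [hU]
    rw [this, Matrix.mulVec_sum]
    ext n
    simp only [Matrix.mulVec_smul, hb, hA.mulVec_eigenvectorBasis, Finset.sum_apply, hU]
    refine Finset.sum_congr rfl fun k _ => ?_
    simp [hlam]; ring
  · intro h
    have := EuclideanSpace.norm_sq_eq (WithLp.toLp 2 (U h))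
    rw [hUv, LinearIsometryEquiv.norm_map, EuclideanSpace.norm_sq_eq, ← hUv] at this
    simp only at this
    rw [← this, hνint]
    refine Finset.sum_congr rfl fun k _ => ?_
    rw [norm_mul, mul_pow, smul_eq_mul, mul_comm]
  · intro h
    rw [hνint, hU]
    refine Finset.sum_congr rfl fun k _ => ?_
    rw [hbo, norm_star, ← Complex.normSq_eq_norm_sq, Complex.real_smul, Complex.normSq_eq_conj_mul_self]
    simp only [RCLike.star_def]; ring

/-- The matrix entries of the operator. -/
def entry {d : Domain} (V : d.sites → ℝ) (n m : d.sites) : ℂ :=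
  (if (m : ℤ) = n + 1 then 1 else 0) + (if (m : ℤ) = n - 1 then 1 else 0) +
    (if (m : ℤ) = n then (V n : ℂ) else 0)

theorem entry_star {d : Domain} (V : d.sites → ℝ) (n m : d.sites) :
    star (entry V n m) = entry V m n := by
  unfold entry
  by_cases h : (m : ℤ) = n
  · have : m = n := Subtype.ext h
    subst this
    simp
  · have h1 : ((n : ℤ) = m + 1) ↔ ((m : ℤ) = n - 1) := by omega
    have h2 : ((n : ℤ) = m - 1) ↔ ((m : ℤ) = n + 1) := by omega
    have h3 : ¬ ((n : ℤ) = m) := by omega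
    simp only [h, h1, h2, h3, if_false, add_zero, RCLike.star_def, map_add]
    split_ifs <;> simp

theorem entry_eq_zero {d : Domain} (V : d.sites → ℝ) {n m : d.sites}
    (h : 1 < |(n : ℤ) - m|) : entry V n m = 0 := by
  unfold entry
  rw [lt_abs] at h
  have h1 : ¬ ((m : ℤ) = n + 1) := by omega
  have h2 : ¬ ((m : ℤ) = n - 1) := by omega
  have h3 : ¬ ((m : ℤ) = n) := by omega
  simp [h1, h2, h3]

theorem sum_zeroExt {d : Domain} (F : Finset d.sites) (f : d.sites → ℂ) (k : ℤ)
    (hk : ∀ h : k ∈ d.sites, (⟨k, h⟩ : d.sites) ∈ F) :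
    ∑ m ∈ F, (if (m : ℤ) = k then (1 : ℂ) else 0) * f m = zeroExt f k := by
  by_cases h : k ∈ d.sites
  · rw [Finset.sum_eq_single_of_mem ⟨k, h⟩ (hk h)]
    · simp [zeroExt, h]
    · intro b _ hb
      rw [if_neg, zero_mul]
      exact fun h' => hb (Subtype.ext h')
  · rw [zeroExt_of_notMem f h]
    refine Finset.sum_eq_zero fun m _ => ?_
    rw [if_neg, zero_mul]
    rintro rfl
    exact h m.2

theorem sum_entry {d : Domain} (V : d.sites → ℝ) (F : Finset d.sites) (f : d.sites → ℂ)
    (n : d.sites) (hF : ∀ m : d.sites, |(n : ℤ) - m| ≤ 1 → m ∈ F) :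
    ∑ m ∈ F, entry V n m * f m = expr V f n := by
  have h1 := sum_zeroExt F f (n + 1) (fun h => hF _ (by simp))
  have h2 := sum_zeroExt F f (n - 1) (fun h => hF _ (by simp))
  have h3 := sum_zeroExt F f n (fun h => hF _ (by simp))
  rw [zeroExt_coe] at h3
  rw [expr, ← h1, ← h2, ← h3, Finset.mul_sum, ← Finset.sum_add_distrib, ← Finset.sum_add_distrib]
  refine Finset.sum_congr rfl fun m _ => ?_
  unfold entry
  split_ifs <;> ring

theorem near_finite {d : Domain} (n : d.sites) (r : ℤ) :
    {m : d.sites | |(n : ℤ) - m| ≤ r}.Finite := by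
  refine Set.Finite.of_finite_image (f := ((↑) : d.sites → ℤ)) ?_ Subtype.val_injective.injOn
  refine (Set.finite_Icc ((n : ℤ) - r) (n + r)).subset ?_
  rintro _ ⟨m, hm, rfl⟩
  have := abs_le.1 (show |(n : ℤ) - m| ≤ r from hm)
  constructor <;> omega

theorem sum_le_sum_of_support {ι : Type*} (f : ι → ℝ) (hf : ∀ i, 0 ≤ f i) (s t : Finset ι)
    (h : ∀ i, f i ≠ 0 → i ∈ t) : ∑ i ∈ s, f i ≤ ∑ i ∈ t, f i := by
  classical
  rw [← Finset.sum_filter_ne_zero s]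
  refine Finset.sum_le_sum_of_subset_of_nonneg ?_ fun i _ _ => hf i
  intro i hi
  exact h i (Finset.mem_filter.1 hi).2

/-- The fourth moments of the spectral measures of the finite sections are bounded. -/
theorem section_bound {d : Domain} (V : d.sites → ℝ) (o : d.sites) :
    ∃ K : ℝ, 0 ≤ K ∧ ∀ F : Finset d.sites,
      ∑ n ∈ F, ‖∑ m ∈ F, entry V n m * entry V m o‖ ^ 2 ≤ K := by
  let G : Finset d.sites := (near_finite o 2).toFinset
  have hG : ∀ m, m ∈ G ↔ |(o : ℤ) - m| ≤ 2 := by simp [G]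
  refine ⟨∑ n ∈ G, (∑ m ∈ G, ‖entry V n m * entry V m o‖) ^ 2, by positivity, fun F => ?_⟩
  have hz : ∀ n m : d.sites, entry V n m * entry V m o ≠ 0 → m ∈ G ∧ n ∈ G := by
    intro n m h
    have h1 : |(n : ℤ) - m| ≤ 1 := not_lt.1 fun h' => h (by rw [entry_eq_zero V h', zero_mul])
    have h2 : |(m : ℤ) - o| ≤ 1 := not_lt.1 fun h' => h (by rw [entry_eq_zero V h', mul_zero])
    rw [hG, hG]
    rw [abs_le] at *
    rw [abs_le]
    omega
  calc ∑ n ∈ F, ‖∑ m ∈ F, entry V n m * entry V m o‖ ^ 2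
      ≤ ∑ n ∈ F, (∑ m ∈ G, ‖entry V n m * entry V m o‖) ^ 2 := by
        gcongr with n _
        refine (norm_sum_le _ _).trans ?_
        refine sum_le_sum_of_support _ (fun _ => norm_nonneg _) _ _ fun m hm => ?_
        exact (hz n m (norm_ne_zero_iff.1 hm)).1
    _ ≤ _ := by
        refine sum_le_sum_of_support _ (fun _ => by positivity) _ _ fun n hn => ?_
        obtain ⟨m, _, hm⟩ := Finset.exists_ne_zero_of_sum_ne_zero (pow_ne_zero_iff two_ne_zero |>.1 hn)
        exact (hz n m (norm_ne_zero_iff.1 hm)).2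

/-- Spectral resolution of a finite section, extended by zero: `W h = h(H_F) δ_o`. -/
theorem section_spectral {d : Domain} (V : d.sites → ℝ) (o : d.sites) (F : Finset d.sites)
    (ho : o ∈ F) :
    ∃ (ν : ProbabilityMeasure ℝ) (W : (ℝ → ℂ) →ₗ[ℂ] (d.sites → ℂ)),
      W 1 = Pi.single o 1 ∧
      (∀ h (n : d.sites), (∀ m : d.sites, |(n : ℤ) - m| ≤ 1 → m ∈ F) →
        expr V (W h) n = W (fun x => (x : ℂ) * h x) n) ∧
      (∀ h (s : Finset d.sites), ∑ n ∈ s, ‖W h n‖ ^ 2 ≤ ∫ x, ‖h x‖ ^ 2 ∂(ν : Measure ℝ)) ∧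
      (∀ h, W h o = ∫ x, h x ∂(ν : Measure ℝ)) ∧
      (∀ h : ℝ → ℝ, Integrable h (ν : Measure ℝ)) ∧
      ∫ x, x ^ 4 ∂(ν : Measure ℝ) =
        ∑ n ∈ F, ‖∑ m ∈ F, entry V n m * entry V m o‖ ^ 2 := by
  classical
  let A : Matrix F F ℂ := Matrix.of fun n m => entry V n m
  have hA : A.IsHermitian := by
    ext n m
    exact entry_star V m n
  obtain ⟨ν, U, hν, h1, h2, h3, h4, h5⟩ := finite_spectral A hA ⟨o, ho⟩
  let W : (ℝ → ℂ) →ₗ[ℂ] (d.sites → ℂ) :=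
    { toFun := fun h n => if hn : n ∈ F then U h ⟨n, hn⟩ else 0
      map_add' := by intro h g; ext n; by_cases hn : n ∈ F <;> simp [hn]
      map_smul' := by intro c h; ext n; by_cases hn : n ∈ F <;> simp [hn] }
  have hW : ∀ h n, W h n = if hn : n ∈ F then U h ⟨n, hn⟩ else 0 := fun _ _ => rfl
  have hWF : ∀ h (n : F), W h n = U h n := by intro h n; simp [hW]
  refine ⟨⟨ν, hν⟩, W, ?_, ?_, ?_, ?_, h5, ?_⟩
  · ext n
    by_cases hn : n ∈ F
    · simp [hW, hn, h1, Pi.single_apply]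
    · have : n ≠ o := by rintro rfl; exact hn ho
      simp [hW, hn, this]
  · intro h n hn
    have hnF : n ∈ F := hn n (by simp)
    rw [← sum_entry V F _ n hn, hW, dif_pos hnF, ← h2, Matrix.mulVec, dotProduct,
      ← Finset.sum_coe_sort]
    refine Finset.sum_congr rfl fun m _ => ?_
    rw [hWF]; rfl
  · intro h s
    refine le_trans ?_ (h3 h).le
    have e : ∑ n, ‖U h n‖ ^ 2 = ∑ n ∈ F, ‖W h n‖ ^ 2 := by
      rw [← Finset.sum_coe_sort F]
      exact Finset.sum_congr rfl fun n _ => by rw [hWF h n]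
    rw [e]
    refine sum_le_sum_of_support _ (fun _ => by positivity) _ _ fun n hn => ?_
    by_contra hnF
    exact hn (by simp [hW, hnF])
  · intro h
    rw [hW, dif_pos ho, h4]; rfl
  · have e : U (fun x : ℝ => (x : ℂ) * ((x : ℂ) * 1)) = A.mulVec (A.mulVec (Pi.single ⟨o, ho⟩ 1)) := by
      rw [← h1, h2, h2]; rfl
    have e3 : A.mulVec (Pi.single ⟨o, ho⟩ 1) = fun m : F => entry V m o := by
      ext m
      rw [Matrix.mulVec_single_one]; rfl
    have h6 := h3 (fun x : ℝ => (x : ℂ) * ((x : ℂ) * 1))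
    rw [e] at h6
    have e2 : ∀ x : ℝ, ‖(x : ℂ) * ((x : ℂ) * 1)‖ ^ 2 = x ^ 4 := by
      intro x
      rw [norm_mul, norm_mul, norm_one, Complex.norm_real, Real.norm_eq_abs]
      rw [show (|x| * (|x| * 1)) ^ 2 = (|x| ^ 2) ^ 2 by ring, sq_abs]; ring
    simp_rw [e2] at h6
    change ∫ x, x ^ 4 ∂ν = _
    rw [← h6, ← Finset.sum_coe_sort F]
    refine Finset.sum_congr rfl fun n _ => ?_
    rw [← Finset.sum_coe_sort F, e3]
    rfl

/-- Spectral resolution of the operator at `δ_o`, as a limit of finite sections: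
`R h = h(H) δ_o` for functions of at most quadratic growth, with the spectral measure `μ`. -/
theorem exists_resolution {d : Domain} (V : d.sites → ℝ) (o : d.sites) :
    ∃ (μ : ProbabilityMeasure ℝ) (R : (ℝ → ℂ) → d.ell2) (K : ℝ), 0 ≤ K ∧
      R 1 = lp.single 2 o 1 ∧
      (∀ (h k : ℝ → ℂ) (a b : ℂ) (c c' : ℝ), (∀ x, ‖h x‖ ≤ c * (1 + x ^ 2)) →
        (∀ x, ‖k x‖ ≤ c' * (1 + x ^ 2)) → R (a • h + b • k) = a • R h + b • R k) ∧
      (∀ (h : ℝ → ℂ) (c c' : ℝ), (∀ x, ‖h x‖ ≤ c * (1 + x ^ 2)) →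
        (∀ x : ℝ, ‖(x : ℂ) * h x‖ ≤ c' * (1 + x ^ 2)) →
          expr V (R h) = R (fun x => (x : ℂ) * h x)) ∧
      (∀ (h : ℝ → ℂ) (c : ℝ), (∀ x, ‖h x‖ ≤ c * (1 + x ^ 2)) → ‖R h‖ ≤ c * K) ∧
      (∀ (h : ℝ → ℂ) (c : ℝ), (∀ x, ‖h x‖ ≤ c) → Continuous h →
        R h o = ∫ x, h x ∂(μ : Measure ℝ)) := by
  obtain ⟨K, hK, hKF⟩ := section_bound V o
  have hex := fun (F : Finset d.sites) (ho : o ∈ F) => section_spectral V o F ho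
  have hex' : ∀ F : Finset d.sites, ∃ (ν : ProbabilityMeasure ℝ)
      (W : (ℝ → ℂ) →ₗ[ℂ] (d.sites → ℂ)), o ∈ F →
      W 1 = Pi.single o 1 ∧
      (∀ h (n : d.sites), (∀ m : d.sites, |(n : ℤ) - m| ≤ 1 → m ∈ F) →
        expr V (W h) n = W (fun x => (x : ℂ) * h x) n) ∧
      (∀ h (s : Finset d.sites), ∑ n ∈ s, ‖W h n‖ ^ 2 ≤ ∫ x, ‖h x‖ ^ 2 ∂(ν : Measure ℝ)) ∧
      (∀ h, W h o = ∫ x, h x ∂(ν : Measure ℝ)) ∧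
      (∀ h : ℝ → ℝ, Integrable h (ν : Measure ℝ)) ∧
      ∫ x, x ^ 4 ∂(ν : Measure ℝ) ≤ K := by
    intro F
    by_cases ho : o ∈ F
    · obtain ⟨ν, W, h1, h2, h3, h4, h5, h6⟩ := hex F ho
      exact ⟨ν, W, fun _ => ⟨h1, h2, h3, h4, h5, h6.trans_le (hKF F)⟩⟩
    · exact ⟨⟨Measure.dirac 0, inferInstance⟩, 0, fun h => absurd h ho⟩
  choose ν W hp using hex'
  let U : Ultrafilter (Finset d.sites) := Ultrafilter.of atTop
  have hU : (U : Filter (Finset d.sites)) ≤ atTop := Ultrafilter.of_le _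
  have hUo : ∀ᶠ F in (U : Filter (Finset d.sites)), o ∈ F :=
    hU ((eventually_ge_atTop ({o} : Finset d.sites)).mono fun F hF => by simpa using hF)
  -- uniform bounds
  have hbd : ∀ (h : ℝ → ℂ) (c : ℝ), (∀ x, ‖h x‖ ≤ c * (1 + x ^ 2)) →
      ∀ F, o ∈ F → ∀ s : Finset d.sites, ∑ n ∈ s, ‖W F h n‖ ^ 2 ≤ c ^ 2 * (2 + 2 * K) := by
    intro h c hc F ho s
    obtain ⟨-, -, h3, -, h5, h6⟩ := hp F ho
    calc ∑ n ∈ s, ‖W F h n‖ ^ 2 ≤ ∫ x, ‖h x‖ ^ 2 ∂(ν F : Measure ℝ) := h3 h s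
      _ ≤ ∫ x, c ^ 2 * (2 + 2 * x ^ 4) ∂(ν F : Measure ℝ) := by
        refine integral_mono (h5 _) (h5 _) fun x => ?_
        calc ‖h x‖ ^ 2 ≤ (c * (1 + x ^ 2)) ^ 2 := by gcongr; exact hc x
          _ = c ^ 2 * (1 + x ^ 2) ^ 2 := by ring
          _ ≤ c ^ 2 * (2 + 2 * x ^ 4) := by
            gcongr; nlinarith [sq_nonneg (1 - x ^ 2)]
      _ = c ^ 2 * (2 + 2 * ∫ x, x ^ 4 ∂(ν F : Measure ℝ)) := by
        rw [integral_const_mul, integral_add (h5 _) (h5 _), integral_const_mul]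
        simp
      _ ≤ _ := by gcongr
  have hlim : ∀ (h : ℝ → ℂ) (c : ℝ), (∀ x, ‖h x‖ ≤ c * (1 + x ^ 2)) → ∀ n,
      ∃ a, Tendsto (fun F => W F h n) U (𝓝 a) := by
    intro h c hc n
    have hB : ∀ᶠ F in (U : Filter (Finset d.sites)),
        W F h n ∈ Metric.closedBall (0 : ℂ) (√(c ^ 2 * (2 + 2 * K))) := by
      filter_upwards [hUo] with F ho
      rw [mem_closedBall_zero_iff]
      refine Real.le_sqrt_of_sq_le ?_
      simpa using hbd h c hc F ho {n}
    obtain ⟨a, -, ha⟩ := (isCompact_closedBall (0 : ℂ) _).ultrafilter_le_nhds'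
      (U.map fun F => W F h n) hB
    exact ⟨a, ha⟩
  let f : (ℝ → ℂ) → d.sites → ℂ := fun h n => limUnder (U : Filter _) fun F => W F h n
  have hf : ∀ (h : ℝ → ℂ) (c : ℝ), (∀ x, ‖h x‖ ≤ c * (1 + x ^ 2)) → ∀ n,
      Tendsto (fun F => W F h n) U (𝓝 (f h n)) := fun h c hc n =>
    tendsto_nhds_limUnder (hlim h c hc n)
  have hsum : ∀ (h : ℝ → ℂ) (c : ℝ), (∀ x, ‖h x‖ ≤ c * (1 + x ^ 2)) →
      ∀ s : Finset d.sites, ∑ n ∈ s, ‖f h n‖ ^ 2 ≤ c ^ 2 * (2 + 2 * K) := by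
    intro h c hc s
    refine le_of_tendsto (tendsto_finsetSum s fun n _ => ((hf h c hc n).norm.pow 2)) ?_
    filter_upwards [hUo] with F ho using hbd h c hc F ho s
  have hmem : ∀ (h : ℝ → ℂ) (c : ℝ), (∀ x, ‖h x‖ ≤ c * (1 + x ^ 2)) → Memℓp (f h) 2 :=
    fun h c hc => memℓp_gen' (C := c ^ 2 * (2 + 2 * K)) fun s => by simpa using hsum h c hc s
  classical
  let R : (ℝ → ℂ) → d.ell2 := fun h => if hm : Memℓp (f h) 2 then ⟨f h, hm⟩ else 0
  have hR : ∀ (h : ℝ → ℂ) (c : ℝ), (∀ x, ‖h x‖ ≤ c * (1 + x ^ 2)) → ∀ n, R h n = f h n := by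
    intro h c hc n
    simp only [R, dif_pos (hmem h c hc)]
  -- the weak limit of the measures
  have htight : ∀ F, o ∈ F → ∀ n : ℕ, ν F (Metric.closedBall (0 : ℝ) n)ᶜ ≤
      Real.toNNReal ((K + 1) / (n + 1)) := by
    intro F ho n
    obtain ⟨-, -, -, -, h5, h6⟩ := hp F ho
    rw [← ENNReal.coe_le_coe, ProbabilityMeasure.ennreal_coeFn_eq_coeFn_toMeasure,
      ← ENNReal.ofReal, ENNReal.le_ofReal_iff_toReal_le (measure_ne_top _ _) (by positivity)]
    change (ν F : Measure ℝ).real _ ≤ _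
    have hm := mul_meas_ge_le_integral_of_nonneg (μ := (ν F : Measure ℝ))
      (f := fun x : ℝ => x ^ 4 + 1)
      (ae_of_all _ fun x => by positivity) (h5 _) (n + 1 : ℝ)
    rw [integral_add (h5 _) (h5 _)] at hm
    rw [le_div_iff₀ (by positivity), mul_comm]
    have hsub : (Metric.closedBall (0 : ℝ) n)ᶜ ⊆ {x : ℝ | (n + 1 : ℝ) ≤ x ^ 4 + 1} := by
      intro x hx
      simp only [Set.mem_compl_iff, mem_closedBall_zero_iff, not_le, Real.norm_eq_abs] at hx
      have hx4 : x ^ 4 = |x| ^ 4 := (Even.pow_abs (by decide) x).symm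
      simp only [Set.mem_ofPred_eq, hx4, add_le_add_iff_right]
      rcases Nat.eq_zero_or_pos n with rfl | hn
      · simp
      · have : (1 : ℝ) ≤ n := by exact_mod_cast hn
        have h1 : (1 : ℝ) ≤ |x| := this.trans hx.le
        calc (n : ℝ) ≤ |x| := hx.le
          _ ≤ |x| ^ 4 := le_self_pow₀ h1 (by norm_num)
    calc (n + 1 : ℝ) * (ν F : Measure ℝ).real (Metric.closedBall (0 : ℝ) n)ᶜ
        ≤ (n + 1 : ℝ) * (ν F : Measure ℝ).real {x : ℝ | (n + 1 : ℝ) ≤ x ^ 4 + 1} :=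
          mul_le_mul_of_nonneg_left (measureReal_mono hsub (measure_ne_top _ _)) (by positivity)
      _ ≤ _ := hm
      _ ≤ _ := by simpa using h6
  obtain ⟨μ, -, hμ⟩ := (isCompact_setOfPred_probabilityMeasure_mass_eq_compl_isCompact_le
    (E := ℝ) (u := fun n : ℕ => Real.toNNReal ((K + 1) / (n + 1)))
    (K := fun n : ℕ => Metric.closedBall (0 : ℝ) n) (by
      rw [← Real.toNNReal_zero]
      exact (continuous_real_toNNReal.tendsto 0).comp
        (tendsto_const_nhds.div_atTop (tendsto_natCast_atTop_atTop.atTop_add tendsto_const_nhds)))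
    (fun n => isCompact_closedBall _ _) (Or.inl inferInstance)).ultrafilter_le_nhds'
    (U.map ν) (by
      change ∀ᶠ F in (U : Filter (Finset d.sites)), _
      filter_upwards [hUo] with F ho using htight F ho)
  have hμ' : Tendsto ν U (𝓝 μ) := hμ
  refine ⟨μ, R, √(2 + 2 * K), Real.sqrt_nonneg _, ?_, ?_, ?_, ?_, ?_⟩
  · ext n
    have hb : ∀ x : ℝ, ‖(1 : ℝ → ℂ) x‖ ≤ 1 * (1 + x ^ 2) := by
      intro x; simp; positivity
    rw [hR 1 1 hb]
    refine tendsto_nhds_unique (hf 1 1 hb n) ?_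
    refine tendsto_const_nhds.congr' ?_
    filter_upwards [hUo] with F ho
    rw [(hp F ho).1, lp.coeFn_single]
  · intro h k a b c c' hc hc'
    have hb : ∀ x : ℝ, ‖(a • h + b • k) x‖ ≤ (‖a‖ * c + ‖b‖ * c') * (1 + x ^ 2) := by
      intro x
      calc ‖(a • h + b • k) x‖ ≤ ‖a‖ * ‖h x‖ + ‖b‖ * ‖k x‖ := by
            simpa using norm_add_le (a * h x) (b * k x)
        _ ≤ ‖a‖ * (c * (1 + x ^ 2)) + ‖b‖ * (c' * (1 + x ^ 2)) := by
            gcongr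
            · exact hc x
            · exact hc' x
        _ = _ := by ring
    ext n
    simp only [lp.coeFn_add, lp.coeFn_smul, Pi.add_apply, Pi.smul_apply]
    rw [hR _ _ hb, hR _ _ hc, hR _ _ hc']
    refine tendsto_nhds_unique (hf _ _ hb n) ?_
    simpa using ((hf h c hc n).const_mul a).add ((hf k c' hc' n).const_mul b)
  · intro h c c' hc hc'
    have e : ((R h : d.ell2) : d.sites → ℂ) = f h := funext (hR h c hc)
    ext n
    rw [e, hR _ _ hc']
    refine tendsto_nhds_unique ?_ (hf _ _ hc' n)
    have hz : ∀ k : ℤ, Tendsto (fun F => zeroExt (W F h) k) U (𝓝 (zeroExt (f h) k)) := by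
      intro k
      by_cases hk : k ∈ d.sites
      · simpa [zeroExt, hk] using hf h c hc ⟨k, hk⟩
      · simp [zeroExt, hk]
    have ht : Tendsto (fun F => expr V (W F h) n) U (𝓝 (expr V (f h) n)) :=
      ((hz _).add (hz _)).add ((hf h c hc n).const_mul _)
    refine ht.congr' ?_
    have hn : ∀ᶠ F in (U : Filter (Finset d.sites)),
        ∀ m : d.sites, |(n : ℤ) - m| ≤ 1 → m ∈ F :=
      hU ((eventually_ge_atTop (near_finite n 1).toFinset).mono fun F hF m hm =>
        hF (by simpa using hm))
    filter_upwards [hUo, hn] with F ho hn using (hp F ho).2.1 h n hn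
  · intro h c hc
    have hc0 : 0 ≤ c := by simpa using (norm_nonneg _).trans (hc 0)
    refine lp.norm_le_of_forall_sum_le (by simp) (by positivity) fun s => ?_
    have e : (c * √(2 + 2 * K)) ^ 2 = c ^ 2 * (2 + 2 * K) := by
      rw [mul_pow, Real.sq_sqrt (by positivity)]
    simpa [e, hR h c hc] using hsum h c hc s
  · intro h c hc hcont
    have hc0 : 0 ≤ c := (norm_nonneg _).trans (hc 0)
    have hb : ∀ x : ℝ, ‖h x‖ ≤ c * (1 + x ^ 2) := fun x =>
      (hc x).trans (le_mul_of_one_le_right hc0 (by nlinarith [sq_nonneg x]))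
    rw [hR h c hb]
    refine tendsto_nhds_unique (hf h c hb o) ?_
    have ht := (ProbabilityMeasure.tendsto_iff_forall_integral_rclike_tendsto ℂ).1 hμ'
      (BoundedContinuousFunction.ofNormedAddCommGroup h hcont c hc)
    refine Tendsto.congr' ?_ ht
    filter_upwards [hUo] with F ho
    exact ((hp F ho).2.2.2.1 h).symm

theorem norm_exp_sub_le (y : ℝ) :
    ‖Complex.exp (Complex.I * y) - 1 - Complex.I * y‖ ≤ 2 * y ^ 2 := by
  rcases le_or_gt |y| 1 with h | h
  · have h1 : ‖Complex.I * (y : ℂ)‖ = |y| := by simp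
    have := Complex.norm_exp_sub_one_sub_id_le (x := Complex.I * y) (by rw [h1]; exact h)
    rw [h1, sq_abs] at this
    nlinarith [sq_nonneg y]
  · have h1 : ‖Complex.I * (y : ℂ)‖ = |y| := by simp
    have h2 := Real.norm_exp_I_mul_ofReal_sub_one_le (x := y)
    have h3 := norm_sub_le (Complex.exp (Complex.I * y) - 1) (Complex.I * y)
    rw [h1] at h3
    rw [Real.norm_eq_abs] at h2
    nlinarith [sq_abs y, abs_nonneg y]

/-- Existence of the evolution `e^{-itH} δ₁`, of the resolvent `(H - z)⁻¹ δ₁`, and of a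
probability measure that represents both. -/
theorem exists_evolution_measure {d : Domain} (V : d.sites → ℝ) :
    ∃ (ψ : ℝ → d.ell2) (μ : ProbabilityMeasure ℝ), IsEvolution V ψ ∧
      (∀ t : ℝ, ψ t d.one = ∫ x : ℝ, Complex.exp (-Complex.I * t * x) ∂(μ : Measure ℝ)) ∧
      ∀ z : ℂ, z.im ≠ 0 → ∃ φ : (hamiltonian V).domain,
        hamiltonian V φ - z • (φ : d.ell2) = delta d ∧
        (φ : d.ell2) d.one = ∫ x : ℝ, 1 / ((x : ℂ) - z) ∂(μ : Measure ℝ) := by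
  obtain ⟨μ, R, K, hK, h1, hlin, hmul, hnorm, hint⟩ := exists_resolution V d.one
  let e : ℝ → ℝ → ℂ := fun t x => Complex.exp (-Complex.I * t * x)
  have he : ∀ t x, ‖e t x‖ = 1 := by
    intro t x
    have : -Complex.I * t * x = ((-(t * x) : ℝ) : ℂ) * Complex.I := by push_cast; ring
    simp only [e, this, Complex.norm_exp_ofReal_mul_I]
  have hb0 : ∀ t x, ‖e t x‖ ≤ 1 * (1 + x ^ 2) := by
    intro t x; rw [he]; nlinarith [sq_nonneg x]
  have hb1 : ∀ t (x : ℝ), ‖(x : ℂ) * e t x‖ ≤ 1 * (1 + x ^ 2) := by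
    intro t x
    rw [norm_mul, he, Complex.norm_real, Real.norm_eq_abs]
    nlinarith [sq_abs x, sq_nonneg (|x| - 1)]
  have hdom : ∀ t, R (e t) ∈ (hamiltonian V).domain := by
    intro t
    rw [mem_domain_iff, hmul (e t) 1 1 (hb0 t) (hb1 t)]
    exact lp.memℓp _
  have happ : ∀ t, hamiltonian V ⟨R (e t), hdom t⟩ = R (fun x => (x : ℂ) * e t x) := by
    intro t
    ext n
    rw [hamiltonian_apply, hmul (e t) 1 1 (hb0 t) (hb1 t)]
  refine ⟨fun t => R (e t), μ, ⟨?_, fun t => ⟨hdom t, ?_⟩⟩, ?_, ?_⟩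
  · have : e 0 = 1 := by ext x; simp [e]
    simp only [this, h1, delta]
  · rw [happ, hasDerivAt_iff_isLittleO_nhds_zero]
    have hO : (fun s : ℝ => R (e (t + s)) - R (e t) -
        s • -Complex.I • R (fun x => (x : ℂ) * e t x)) =O[𝓝 0] fun s : ℝ => s ^ 2 := by
      refine Asymptotics.IsBigO.of_bound (2 * K) (Eventually.of_forall fun s => ?_)
      let k : ℝ → ℂ := (1 : ℂ) • e (t + s) + (-1 : ℂ) • e t
      have hk : R k = (1 : ℂ) • R (e (t + s)) + (-1 : ℂ) • R (e t) :=
        hlin _ _ _ _ _ _ (hb0 _) (hb0 _)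
      have hkb : ∀ x, ‖k x‖ ≤ 2 * (1 + x ^ 2) := by
        intro x
        have : ‖k x‖ ≤ ‖e (t + s) x‖ + ‖e t x‖ := by
          simpa [k, ← sub_eq_add_neg] using norm_sub_le (e (t + s) x) (e t x)
        rw [he, he] at this
        nlinarith [sq_nonneg x]
      have hl := hlin k (fun x => (x : ℂ) * e t x) 1 (s * Complex.I) _ _ hkb (hb1 t)
      have heq : R (e (t + s)) - R (e t) - s • -Complex.I • R (fun x => (x : ℂ) * e t x) =
          R ((1 : ℂ) • k + (s * Complex.I : ℂ) • fun x : ℝ => (x : ℂ) * e t x) := by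
        have hs : (s • -Complex.I • R (fun x => (x : ℂ) * e t x) : d.ell2) =
            -((s * Complex.I : ℂ) • R (fun x => (x : ℂ) * e t x)) := by
          ext n
          simp only [lp.coeFn_smul, lp.coeFn_neg, Pi.neg_apply, Pi.smul_apply, smul_eq_mul,
            Complex.real_smul]
          ring
        rw [hl, hk, hs]
        simp only [one_smul, neg_smul]
        abel
      rw [heq]
      refine (hnorm _ (2 * s ^ 2) fun x => ?_).trans (by simp; linarith)
      have hx : ((1 : ℂ) • k + (s * Complex.I : ℂ) • fun x : ℝ => (x : ℂ) * e t x) x =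
          e t x * (Complex.exp (Complex.I * ((-(s * x) : ℝ) : ℂ)) - 1 -
            Complex.I * ((-(s * x) : ℝ) : ℂ)) := by
        have hadd : e (t + s) x = e t x * Complex.exp (Complex.I * ((-(s * x) : ℝ) : ℂ)) := by
          simp only [e, ← Complex.exp_add]
          congr 1; push_cast; ring
        simp only [k, Pi.add_apply, Pi.smul_apply, smul_eq_mul, hadd]
        push_cast; ring
      rw [hx, norm_mul, he, one_mul]
      refine (norm_exp_sub_le _).trans ?_
      nlinarith [sq_nonneg s, sq_nonneg (s * x)]
    exact hO.trans_isLittleO (Asymptotics.isLittleO_pow_id (by norm_num))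
  · intro t
    exact hint (e t) 1 (fun x => (he t x).le) (by fun_prop)
  · intro z hz
    let g : ℝ → ℂ := fun x => 1 / ((x : ℂ) - z)
    have hne : ∀ x : ℝ, (x : ℂ) - z ≠ 0 := by
      intro x h0
      apply hz
      have := congrArg Complex.im h0
      simpa using this
    have hg : ∀ x, ‖g x‖ ≤ 1 / |z.im| := by
      intro x
      simp only [g, norm_div, norm_one]
      have h0 : 0 < |z.im| := abs_pos.2 hz
      refine one_div_le_one_div_of_le h0 ?_
      have := Complex.abs_im_le_norm ((x : ℂ) - z)
      simpa using this
    have hz0 : (0 : ℝ) ≤ 1 / |z.im| := by positivity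
    have hgb : ∀ x : ℝ, ‖g x‖ ≤ 1 / |z.im| * (1 + x ^ 2) := fun x =>
      (hg x).trans (le_mul_of_one_le_right hz0 (by nlinarith [sq_nonneg x]))
    have hone : ∀ x : ℝ, ‖(1 : ℝ → ℂ) x‖ ≤ 1 * (1 + x ^ 2) := by
      intro x; simp; positivity
    have hxg : (fun x : ℝ => (x : ℂ) * g x) = (1 : ℂ) • (1 : ℝ → ℂ) + z • g := by
      ext x
      simp only [g, Pi.add_apply, Pi.smul_apply, Pi.one_apply, smul_eq_mul]
      field_simp [hne x]
      ring
    have hxgb : ∀ x : ℝ, ‖(x : ℂ) * g x‖ ≤ (1 + ‖z‖ * (1 / |z.im|)) * (1 + x ^ 2) := by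
      intro x
      have h0 : (x : ℂ) * g x = 1 + z * g x := by simpa using congrFun hxg x
      rw [h0]
      calc ‖1 + z * g x‖ ≤ 1 + ‖z‖ * ‖g x‖ := by simpa using norm_add_le 1 (z * g x)
        _ ≤ 1 + ‖z‖ * (1 / |z.im|) := by gcongr; exact hg x
        _ ≤ _ := le_mul_of_one_le_right (by positivity) (by nlinarith [sq_nonneg x])
    have hexp := hmul g _ _ hgb hxgb
    have hm : R g ∈ (hamiltonian V).domain := by
      rw [mem_domain_iff, hexp]
      exact lp.memℓp _
    refine ⟨⟨R g, hm⟩, ?_, hint g _ hg ?_⟩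
    · have : hamiltonian V ⟨R g, hm⟩ = R (fun x : ℝ => (x : ℂ) * g x) := by
        ext n
        rw [hamiltonian_apply, hexp]
      rw [this, hxg, hlin _ _ _ _ _ _ hone hgb, h1, delta]
      simp
    · exact continuous_const.div (by fun_prop) hne

/-- The time evolution `t ↦ e^{-itH} δ₁`, the unique solution of the Schrödinger equation with
initial value `δ₁`. -/
def evolution {d : Domain} (V : d.sites → ℝ) : ℝ → d.ell2 :=
  Classical.choose (exists_evolution_measure V)

theorem evolution_spec {d : Domain} (V : d.sites → ℝ) : IsEvolution V (evolution V) := by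
  obtain ⟨μ, h, -⟩ := Classical.choose_spec (exists_evolution_measure V)
  exact h

/-- `μ` is the spectral measure of `H` and `δ₁`: `⟨f(H) δ₁, δ₁⟩ = ∫ f dμ` for the functions
`f(x) = e^{-itx}` and `f(x) = 1 / (x - z)`. (Either family alone determines `μ`. The vector `φ` is
`(H - z)⁻¹ δ₁`, and the coordinate at the site `1` is the inner product with `δ₁`.) -/
def IsSpectralMeasure {d : Domain} (V : d.sites → ℝ) (μ : Measure ℝ) : Prop :=
  IsProbabilityMeasure μ ∧
    (∀ t : ℝ, evolution V t d.one = ∫ x : ℝ, Complex.exp (-Complex.I * t * x) ∂μ) ∧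
    ∀ z : ℂ, z.im ≠ 0 → ∃ φ : (hamiltonian V).domain,
      hamiltonian V φ - z • (φ : d.ell2) = delta d ∧
      (φ : d.ell2) d.one = ∫ x : ℝ, 1 / ((x : ℂ) - z) ∂μ

theorem exists_spectralMeasure {d : Domain} (V : d.sites → ℝ) :
    ∃ μ : Measure ℝ, IsSpectralMeasure V μ := by
  obtain ⟨μ, -, h2, h3⟩ := Classical.choose_spec (exists_evolution_measure V)
  exact ⟨μ, inferInstance, h2, h3⟩

/-- The spectral measure of the operator `H` and the vector `δ₁`. -/
def spectralMeasure {d : Domain} (V : d.sites → ℝ) : Measure ℝ :=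
  Classical.choose (exists_spectralMeasure V)

theorem spectralMeasure_spec {d : Domain} (V : d.sites → ℝ) :
    IsSpectralMeasure V (spectralMeasure V) :=
  Classical.choose_spec (exists_spectralMeasure V)

/-- The Borel transform `F(z) = ∫ dμ(x) / (x - z) = ⟨(H - z)⁻¹ δ₁, δ₁⟩`. -/
def borelTransform {d : Domain} (V : d.sites → ℝ) (z : ℂ) : ℂ :=
  ∫ x : ℝ, 1 / ((x : ℂ) - z) ∂(spectralMeasure V)

/-- `I(Δ, ν) = ν ∫_Δ (Im F(E + iν))² dE`. -/
def energyIntegral {d : Domain} (V : d.sites → ℝ) (Δ : Set ℝ) (ν : ℝ) : ℝ :=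
  ν * ∫ E in Δ, (borelTransform V (E + Complex.I * ν)).im ^ 2

/-- The time-averaged probability `a(n, T) = (2/T) ∫_0^∞ e^{-2t/T} |⟨e^{-itH} δ₁, δ_n⟩|² dt`. -/
def avgProb {d : Domain} (V : d.sites → ℝ) (n : d.sites) (T : ℝ) : ℝ :=
  2 / T * ∫ t in Set.Ioi (0 : ℝ), Real.exp (-2 * t / T) * ‖evolution V t n‖ ^ 2

/-- The time-averaged moment `⟨|X|^p⟩(T) = ∑_n |n|^p a(n, T)`, a sum in `[0, ∞]`. -/
def moment {d : Domain} (V : d.sites → ℝ) (p T : ℝ) : ENNReal :=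
  ∑' n : d.sites, ENNReal.ofReal (|((n : ℤ) : ℝ)| ^ p * avgProb V n T)

end

end Schrodinger

/-!
The evolution `ψ t = e ^ {-itH} δ₁` has the same Gram matrix as the plane waves `e ^ {-itx}` in
`L²(μ)`, so a contraction `L²(μ) → ℓ²` sends the plane waves to `ψ`. For a finite set `S` of sites,
project `ψ t` off the span of the `δ_n`, `n ∈ S`, and pair the result with the image of the plane
wave cut off to `A`. Averaging over an exponentially distributed time `t`, Bessel's inequality and
Cauchy-Schwarz bound the averaged mass in `S` by `1 - 3 / 4 * μ(A) + √(#S * κ)`, where `κ` is the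
correlation integral of `μ` over `A` at scale `2 / T`.

The Poisson kernel bounds `κ` by `8 * I(A_{2ε}, ε)`, which is at most `8 * X / g` if the moment `X`
satisfies `g * I(A_{2ε}, ε) ≤ X`. Hence with `ν = μ(A) ^ 2 * g / (32 * X)` the mass beyond distance
`ν / 3` is at least `μ(A) / 4`, so that `(ν / 3) ^ p * μ(A) / 4 ≤ X`; solving for `X` gives the
exponents. If `ν < 1`, the same inequality follows from a lower bound on `X` depending only on `p`,
which is the case `A = ℝ`, `ν = 1`: there `κ` is the averaged probability at the site `1`, and if it
exceeds `1 / 4` the site `1` alone contributes enough to the moment.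
-/

namespace Schrodinger

open scoped ComplexConjugate InnerProduct InnerProductSpace

section Hilbert

variable {𝕜 E F ι : Type*} [RCLike 𝕜] [NormedAddCommGroup E] [InnerProductSpace 𝕜 E]
  [NormedAddCommGroup F] [InnerProductSpace 𝕜 F]

theorem norm_sub_sum_inner_smul_sq {v : ι → E} (hv : Orthonormal 𝕜 v) (S : Finset ι) (x : E) :
    ‖x - ∑ n ∈ S, ⟪v n, x⟫_𝕜 • v n‖ ^ 2 = ‖x‖ ^ 2 - ∑ n ∈ S, ‖⟪v n, x⟫_𝕜‖ ^ 2 := by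
  have hcross : ⟪x, ∑ n ∈ S, ⟪v n, x⟫_𝕜 • v n⟫_𝕜 = ((∑ n ∈ S, ‖⟪v n, x⟫_𝕜‖ ^ 2 : ℝ) : 𝕜) := by
    simp only [inner_sum, inner_smul_right, RCLike.ofReal_sum]
    refine Finset.sum_congr rfl fun n _ => ?_
    rw [← inner_conj_symm x (v n), RCLike.mul_conj, RCLike.ofReal_pow]
  have hsum : ‖∑ n ∈ S, ⟪v n, x⟫_𝕜 • v n‖ ^ 2 = ∑ n ∈ S, ‖⟪v n, x⟫_𝕜‖ ^ 2 := by
    rw [← RCLike.ofReal_inj (K := 𝕜), RCLike.ofReal_pow, ← inner_self_eq_norm_sq_to_K,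
      hv.inner_sum]
    simp only [RCLike.conj_mul, RCLike.ofReal_sum, RCLike.ofReal_pow]
  rw [@norm_sub_sq 𝕜, hcross, hsum, RCLike.ofReal_re]
  ring

theorem re_inner_sub_sum_le {v : ι → E} (hv : Orthonormal 𝕜 v) (S : Finset ι) (f x : E) :
    RCLike.re (⟪f, x⟫_𝕜 - ∑ n ∈ S, ⟪f, v n⟫_𝕜 * ⟪v n, x⟫_𝕜) ≤
      ‖f‖ ^ 2 / 4 + (‖x‖ ^ 2 - ∑ n ∈ S, ‖⟪v n, x⟫_𝕜‖ ^ 2) := by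
  rw [← norm_sub_sum_inner_smul_sq hv]
  set y := x - ∑ n ∈ S, ⟪v n, x⟫_𝕜 • v n with hy
  have hfy : ⟪f, x⟫_𝕜 - ∑ n ∈ S, ⟪f, v n⟫_𝕜 * ⟪v n, x⟫_𝕜 = ⟪f, y⟫_𝕜 := by
    simp only [hy, inner_sub_right, inner_sum, inner_smul_right, mul_comm]
  rw [hfy]
  nlinarith [re_inner_le_norm (𝕜 := 𝕜) f y, sq_nonneg (‖f‖ / 2 - ‖y‖)]

theorem norm_linearCombination_eq_of_inner_eq {e : ι → E} {f : ι → F}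
    (h : ∀ i j, ⟪f i, f j⟫_𝕜 = ⟪e i, e j⟫_𝕜) (c : ι →₀ 𝕜) :
    ‖Finsupp.linearCombination 𝕜 f c‖ = ‖Finsupp.linearCombination 𝕜 e c‖ := by
  rw [norm_eq_sqrt_re_inner (𝕜 := 𝕜), norm_eq_sqrt_re_inner (𝕜 := 𝕜)]
  simp only [Finsupp.linearCombination_apply, Finsupp.sum, sum_inner, inner_sum,
    inner_smul_left, inner_smul_right, h]

variable [CompleteSpace E] [CompleteSpace F]

theorem adjoint_apply_self_of_norm_eq {W : E →L[𝕜] F} (hW : ‖W‖ ≤ 1) {x : E}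
    (hx : ‖W x‖ = ‖x‖) : (W†) (W x) = x := by
  have hle : ‖(W†) (W x)‖ ≤ ‖x‖ := by
    have hadj : ‖W†‖ ≤ 1 := by rwa [LinearIsometryEquiv.norm_map]
    simpa [hx] using (W†).le_of_opNorm_le hadj (W x)
  have hcross : RCLike.re ⟪(W†) (W x), x⟫_𝕜 = ‖x‖ ^ 2 := by
    rw [ContinuousLinearMap.adjoint_inner_left, inner_self_eq_norm_sq, hx]
  have hsq := norm_sub_sq (𝕜 := 𝕜) ((W†) (W x)) x
  have hzero : ‖(W†) (W x) - x‖ ^ 2 ≤ 0 := by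
    rw [hsq, hcross]
    nlinarith [norm_nonneg ((W†) (W x))]
  exact sub_eq_zero.1 (norm_eq_zero.1 (pow_eq_zero_iff two_ne_zero |>.1
    (le_antisymm hzero (sq_nonneg _))))

theorem exists_contraction_of_inner_eq {e : ι → E} {f : ι → F}
    (h : ∀ i j, ⟪f i, f j⟫_𝕜 = ⟪e i, e j⟫_𝕜) :
    ∃ W : E →L[𝕜] F, ‖W‖ ≤ 1 ∧ ∀ i, W (e i) = f i := by
  -- `W` vanishes on the orthogonal complement of the closed span `K` of the `e i`.
  let K := (LinearMap.range (Finsupp.linearCombination 𝕜 e)).topologicalClosure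
  let g : (ι →₀ 𝕜) →ₗ[𝕜] K := (Finsupp.linearCombination 𝕜 e).codRestrict K
    fun c => Submodule.le_topologicalClosure _ ⟨c, rfl⟩
  have hdense : DenseRange g := fun x => by
    have hrange : Subtype.val '' Set.range g =
        (LinearMap.range (Finsupp.linearCombination 𝕜 e) : Set E) := by
      rw [← Set.range_comp]; rfl
    rw [closure_subtype, hrange]
    exact x.2
  have hbound : ∀ c, ‖Finsupp.linearCombination 𝕜 f c‖ ≤ 1 * ‖g c‖ := fun c =>
    ((norm_linearCombination_eq_of_inner_eq h c).trans (one_mul ‖g c‖).symm).le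
  have : CompleteSpace K := (Submodule.isClosed_topologicalClosure _).completeSpace_coe
  let W₀ : K →L[𝕜] F := (Finsupp.linearCombination 𝕜 f).extendOfNorm g
  refine ⟨W₀ ∘L K.orthogonalProjectionOnto, ?_, fun i => ?_⟩
  · refine ContinuousLinearMap.opNorm_le_bound _ zero_le_one fun x => ?_
    calc ‖W₀ (K.orthogonalProjectionOnto x)‖ ≤ 1 * ‖K.orthogonalProjectionOnto x‖ :=
          LinearMap.norm_extendOfNorm_apply_le hdense 1 hbound _
      _ ≤ 1 * ‖x‖ := by gcongr; exact K.norm_orthogonalProjectionOnto_apply_le x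
  · have hg : (g (Finsupp.single i 1) : E) = e i := by
      simp [g, LinearMap.codRestrict_apply]
    rw [ContinuousLinearMap.comp_apply, ← hg,
      Submodule.orthogonalProjectionOnto_mem_subspace_eq_self,
      LinearMap.extendOfNorm_eq hdense ⟨1, hbound⟩]
    simp

end Hilbert

section Bessel

variable {X ι : Type*} [MeasurableSpace X] {μ : Measure X}

theorem inner_Lp_eq_integral {f g : Lp ℂ 2 μ} {f' g' : X → ℂ} (hf : f =ᵐ[μ] f')
    (hg : g =ᵐ[μ] g') : ⟪f, g⟫_ℂ = ∫ x, conj (f' x) * g' x ∂μ := by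
  rw [L2.inner_def]
  refine integral_congr_ae ?_
  filter_upwards [hf, hg] with x hfx hgx
  rw [RCLike.inner_apply, hfx, hgx, mul_comm]

theorem norm_toLp_sq {f : X → ℂ} (hf : MemLp f 2 μ) : ‖hf.toLp f‖ ^ 2 = ∫ x, ‖f x‖ ^ 2 ∂μ := by
  rw [← Complex.ofReal_inj, Complex.ofReal_pow, ← Complex.coe_algebraMap,
    ← inner_self_eq_norm_sq_to_K, inner_Lp_eq_integral hf.coeFn_toLp hf.coeFn_toLp,
    Complex.coe_algebraMap, ← integral_complex_ofReal]
  simp only [Complex.conj_mul', Complex.ofReal_pow]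

theorem integral_mul_le_sqrt_mul_sqrt {f g : X → ℝ} (hf₀ : 0 ≤ f) (hg₀ : 0 ≤ g)
    (hf : MemLp f 2 μ) (hg : MemLp g 2 μ) :
    ∫ x, f x * g x ∂μ ≤ √(∫ x, f x ^ 2 ∂μ) * √(∫ x, g x ^ 2 ∂μ) := by
  have h := integral_mul_le_Lp_mul_Lq_of_nonneg Real.HolderConjugate.two_two
    (ae_of_all μ hf₀) (ae_of_all μ hg₀) (by simpa using hf) (by simpa using hg)
  simpa only [Real.rpow_two, Real.sqrt_eq_rpow] using h

theorem memLp_two_sqrt {f : X → ℝ} (hf₀ : 0 ≤ f) (hf : Integrable f μ) :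
    MemLp (fun x => √(f x)) 2 μ := by
  rw [memLp_two_iff_integrable_sq (Real.continuous_sqrt.comp_aestronglyMeasurable hf.1)]
  simpa only [Real.sq_sqrt (hf₀ _)] using hf

theorem sum_norm_sq_le_card {u : ι → Lp ℂ 2 μ} {S : Finset ι}
    (hu : ∀ g, ∑ n ∈ S, ‖⟪u n, g⟫_ℂ‖ ^ 2 ≤ ‖g‖ ^ 2) :
    ∑ n ∈ S, ‖u n‖ ^ 2 ≤ S.card := by
  refine (Finset.sum_le_card_nsmul S _ 1 fun n hn => ?_).trans_eq (by simp)
  have h : ‖⟪u n, u n⟫_ℂ‖ ^ 2 ≤ ‖u n‖ ^ 2 :=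
    (Finset.single_le_sum (f := fun m => ‖⟪u m, u n⟫_ℂ‖ ^ 2) (fun m _ => sq_nonneg _) hn).trans
      (hu (u n))
  rw [inner_self_eq_norm_sq_to_K, norm_pow, RCLike.norm_ofReal, abs_norm] at h
  nlinarith [sq_nonneg ‖u n‖]

variable [IsFiniteMeasure μ] {K : X → X → ℂ} (hK : StronglyMeasurable (Function.uncurry K)) {C : ℝ}
  (hC : ∀ x y, ‖K x y‖ ≤ C)

include hK hC

theorem memLp_kernel (x : X) : MemLp (K x) 2 μ :=
  MemLp.of_bound (hK.comp_measurable measurable_prodMk_left).aestronglyMeasurable C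
    (ae_of_all _ (hC x))

theorem integrable_integral_norm_kernel_sq : Integrable (fun x => ∫ y, ‖K x y‖ ^ 2 ∂μ) μ := by
  have hint : Integrable (fun z : X × X => ‖K z.1 z.2‖ ^ 2) (μ.prod μ) := by
    refine Integrable.of_bound (hK.norm.pow 2).aestronglyMeasurable (C ^ 2)
      (ae_of_all _ fun z => ?_)
    rw [norm_pow, norm_norm]
    gcongr
    exact hC z.1 z.2
  exact hint.integral_prod_left

variable {u : ι → Lp ℂ 2 μ} {S : Finset ι}

theorem sum_norm_integral_mul_kernel_sq_le (hu : ∀ g, ∑ n ∈ S, ‖⟪u n, g⟫_ℂ‖ ^ 2 ≤ ‖g‖ ^ 2) (x : X) :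
    ∑ n ∈ S, ‖∫ y, conj (u n y) * K x y ∂μ‖ ^ 2 ≤ ∫ y, ‖K x y‖ ^ 2 ∂μ := by
  have hKx := memLp_kernel (μ := μ) hK hC x
  simpa only [inner_Lp_eq_integral EventuallyEq.rfl hKx.coeFn_toLp, norm_toLp_sq]
    using hu (hKx.toLp (K x))

theorem memLp_integral_mul_kernel (hu : ∀ g, ∑ n ∈ S, ‖⟪u n, g⟫_ℂ‖ ^ 2 ≤ ‖g‖ ^ 2) {n : ι}
    (hn : n ∈ S) : MemLp (fun x => ∫ y, conj (u n y) * K x y ∂μ) 2 μ := by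
  have hmeas : AEStronglyMeasurable (fun z : X × X => conj (u n z.2) * K z.1 z.2) (μ.prod μ) :=
    (RCLike.continuous_conj.comp_stronglyMeasurable
      ((Lp.stronglyMeasurable (u n)).comp_measurable measurable_snd)).mul hK |>.aestronglyMeasurable
  have hsqrt := memLp_two_sqrt (fun x => integral_nonneg fun y => sq_nonneg ‖K x y‖)
    (integrable_integral_norm_kernel_sq (μ := μ) hK hC)
  refine hsqrt.mono hmeas.integral_prod_right' (ae_of_all _ fun x => ?_)
  rw [Real.norm_of_nonneg (Real.sqrt_nonneg _)]
  exact Real.le_sqrt_of_sq_le ((Finset.single_le_sum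
    (f := fun m => ‖∫ y, conj (u m y) * K x y ∂μ‖ ^ 2) (fun m _ => sq_nonneg _) hn).trans
      (sum_norm_integral_mul_kernel_sq_le hK hC hu x))

theorem norm_sum_mul_integral_kernel_le (hu : ∀ g, ∑ n ∈ S, ‖⟪u n, g⟫_ℂ‖ ^ 2 ≤ ‖g‖ ^ 2) (x : X) :
    ‖∑ n ∈ S, u n x * ∫ y, conj (u n y) * K x y ∂μ‖ ≤
      √(∑ n ∈ S, ‖u n x‖ ^ 2) * √(∫ y, ‖K x y‖ ^ 2 ∂μ) := by
  calc ‖∑ n ∈ S, u n x * ∫ y, conj (u n y) * K x y ∂μ‖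
      ≤ ∑ n ∈ S, ‖u n x‖ * ‖∫ y, conj (u n y) * K x y ∂μ‖ :=
        norm_sum_le_of_le S fun n _ => norm_mul_le _ _
    _ ≤ √(∑ n ∈ S, ‖u n x‖ ^ 2) * √(∑ n ∈ S, ‖∫ y, conj (u n y) * K x y ∂μ‖ ^ 2) :=
        Real.sum_mul_le_sqrt_mul_sqrt S _ _
    _ ≤ √(∑ n ∈ S, ‖u n x‖ ^ 2) * √(∫ y, ‖K x y‖ ^ 2 ∂μ) := by
        gcongr
        exact sum_norm_integral_mul_kernel_sq_le hK hC hu x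

theorem norm_sum_setIntegral_mul_kernel_le
    (hu : ∀ g, ∑ n ∈ S, ‖⟪u n, g⟫_ℂ‖ ^ 2 ≤ ‖g‖ ^ 2) (A : Set X) :
    ‖∑ n ∈ S, ∫ x in A, u n x * ∫ y, conj (u n y) * K x y ∂μ ∂μ‖ ≤
      √(S.card * ∫ x in A, ∫ y, ‖K x y‖ ^ 2 ∂μ ∂μ) := by
  have hu_int : Integrable (fun x => ∑ n ∈ S, ‖u n x‖ ^ 2) μ :=
    integrable_finsetSum S fun n _ => (Lp.memLp (u n)).integrable_norm_pow (by norm_num)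
  have hK_int := integrable_integral_norm_kernel_sq (μ := μ) hK hC
  have hu₀ : (0 : X → ℝ) ≤ fun x => ∑ n ∈ S, ‖u n x‖ ^ 2 := fun x => by positivity
  have hK₀ : (0 : X → ℝ) ≤ fun x => ∫ y, ‖K x y‖ ^ 2 ∂μ := fun x => by positivity
  have hu_sqrt := (memLp_two_sqrt hu₀ hu_int).restrict A
  have hK_sqrt := (memLp_two_sqrt hK₀ hK_int).restrict A
  have hcard : ∫ x in A, ∑ n ∈ S, ‖u n x‖ ^ 2 ∂μ ≤ S.card := by
    refine (setIntegral_le_integral hu_int (ae_of_all _ hu₀)).trans ?_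
    rw [integral_finsetSum S fun n _ => (Lp.memLp (u n)).integrable_norm_pow (by norm_num)]
    simpa only [← norm_toLp_sq (Lp.memLp _), Lp.toLp_coeFn] using sum_norm_sq_le_card hu
  have hterm_int : ∀ n ∈ S, Integrable (fun x => u n x * ∫ y, conj (u n y) * K x y ∂μ)
      (μ.restrict A) := fun n hn =>
    ((Lp.memLp (u n)).integrable_mul (memLp_integral_mul_kernel hK hC hu hn)).restrict
  rw [← integral_finsetSum S hterm_int]
  calc ‖∫ x in A, ∑ n ∈ S, u n x * ∫ y, conj (u n y) * K x y ∂μ ∂μ‖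
      ≤ ∫ x in A, √(∑ n ∈ S, ‖u n x‖ ^ 2) * √(∫ y, ‖K x y‖ ^ 2 ∂μ) ∂μ :=
        norm_integral_le_of_norm_le (hu_sqrt.integrable_mul hK_sqrt)
          (ae_of_all _ (norm_sum_mul_integral_kernel_le hK hC hu))
    _ ≤ √(∫ x in A, ∑ n ∈ S, ‖u n x‖ ^ 2 ∂μ) * √(∫ x in A, ∫ y, ‖K x y‖ ^ 2 ∂μ ∂μ) := by
        simpa only [Real.sq_sqrt (hu₀ _), Real.sq_sqrt (hK₀ _)] using
          integral_mul_le_sqrt_mul_sqrt (fun _ => Real.sqrt_nonneg _) (fun _ => Real.sqrt_nonneg _)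
            hu_sqrt hK_sqrt
    _ ≤ √S.card * √(∫ x in A, ∫ y, ‖K x y‖ ^ 2 ∂μ ∂μ) := by gcongr
    _ = √(S.card * ∫ x in A, ∫ y, ‖K x y‖ ^ 2 ∂μ ∂μ) := (Real.sqrt_mul (by positivity) _).symm

end Bessel

section AverageKernel

variable {X Θ : Type*} [MeasurableSpace Θ] {ρ : Measure Θ} {w : Θ → X → ℂ}

/-- The kernel `∫ conj (w t x) w t y dρ(t)` of correlations between `x` and `y` of the family `w`,
averaged over the parameter `t`. -/
noncomputable def averageKernel (ρ : Measure Θ) (w : Θ → X → ℂ) (x y : X) : ℂ :=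
  ∫ t, conj (w t x) * w t y ∂ρ

theorem norm_averageKernel_le_one [IsProbabilityMeasure ρ] (hw : ∀ t x, ‖w t x‖ = 1) (x y : X) :
    ‖averageKernel ρ w x y‖ ≤ 1 := by
  refine (norm_integral_le_of_norm_le_const (C := 1) (ae_of_all _ fun t => ?_)).trans (by simp)
  simp [hw]

variable [MeasurableSpace X]

theorem stronglyMeasurable_averageKernel [SFinite ρ] (hw : Measurable (Function.uncurry w)) :
    StronglyMeasurable (Function.uncurry (averageKernel ρ w)) := by
  have hw' : Measurable fun q : (X × X) × Θ => conj (w q.2 q.1.1) * w q.2 q.1.2 := by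
    have h₁ : Measurable fun q : (X × X) × Θ => w q.2 q.1.1 :=
      hw.comp (measurable_snd.prodMk measurable_fst.fst)
    have h₂ : Measurable fun q : (X × X) × Θ => w q.2 q.1.2 :=
      hw.comp (measurable_snd.prodMk measurable_fst.snd)
    exact (RCLike.continuous_conj.measurable.comp h₁).mul h₂
  exact hw'.stronglyMeasurable.integral_prod_right

theorem integral_mul_integral_eq_averageKernel [IsProbabilityMeasure ρ]
    (hwm : Measurable (Function.uncurry w)) (hw : ∀ t x, ‖w t x‖ = 1) {μ₁ μ₂ : Measure X}
    [SFinite μ₁] [SFinite μ₂] {a b : X → ℂ} (ha : Integrable a μ₁) (hb : Integrable b μ₂) :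
    Integrable (fun t => (∫ x, conj (w t x) * a x ∂μ₁) * ∫ y, b y * w t y ∂μ₂) ρ ∧
    ∫ t, (∫ x, conj (w t x) * a x ∂μ₁) * ∫ y, b y * w t y ∂μ₂ ∂ρ =
      ∫ x, a x * ∫ y, b y * averageKernel ρ w x y ∂μ₂ ∂μ₁ := by
  have hb' : ∀ x, a x * ∫ y, b y * averageKernel ρ w x y ∂μ₂ =
      ∫ y, a x * b y * averageKernel ρ w x y ∂μ₂ := fun x => by
    simp only [mul_assoc, integral_const_mul]
  have hprod : ∀ t, (∫ x, conj (w t x) * a x ∂μ₁) * ∫ y, b y * w t y ∂μ₂ =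
      ∫ z, a z.1 * b z.2 * (conj (w t z.1) * w t z.2) ∂(μ₁.prod μ₂) := fun t => by
    rw [← integral_prod_mul]
    exact integral_congr_ae (ae_of_all _ fun z => by ring)
  have hint : Integrable (Function.uncurry fun t (z : X × X) =>
      a z.1 * b z.2 * (conj (w t z.1) * w t z.2)) (ρ.prod (μ₁.prod μ₂)) := by
    have h₁ : Measurable fun q : Θ × X × X => w q.1 q.2.1 :=
      hwm.comp (measurable_fst.prodMk measurable_snd.fst)
    have h₂ : Measurable fun q : Θ × X × X => w q.1 q.2.2 :=
      hwm.comp (measurable_fst.prodMk measurable_snd.snd)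
    have hmeas : Measurable fun q : Θ × X × X => conj (w q.1 q.2.1) * w q.1 q.2.2 :=
      (RCLike.continuous_conj.measurable.comp h₁).mul h₂
    exact ((ha.mul_prod hb).comp_snd ρ).mul_bdd (c := 1) hmeas.aestronglyMeasurable
      (ae_of_all _ fun q => by simp [hw])
  simp only [hprod]
  refine ⟨hint.integral_prod_left, ?_⟩
  rw [integral_integral_swap hint]
  simp only [integral_const_mul, hb']
  exact integral_prod _ ((ha.mul_prod hb).mul_bdd (c := 1)
    (stronglyMeasurable_averageKernel hwm).aestronglyMeasurable
    (ae_of_all _ fun z => norm_averageKernel_le_one hw _ _))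

theorem integrable_norm_integral_mul_sq [IsProbabilityMeasure ρ]
    (hwm : Measurable (Function.uncurry w))
    (hw : ∀ t x, ‖w t x‖ = 1) {μ : Measure X} [SFinite μ] {u : X → ℂ}
    (hu : Integrable u μ) :
    Integrable (fun t => ‖∫ x, conj (u x) * w t x ∂μ‖ ^ 2) ρ := by
  have huc : Integrable (fun x => conj (u x)) μ :=
    (LinearIsometryEquiv.integrable_comp_iff RCLike.conjLIE).2 hu
  refine (integral_mul_integral_eq_averageKernel hwm hw hu huc).1.norm.congr
    (ae_of_all _ fun t => ?_)
  have hconj : ∫ x, conj (w t x) * u x ∂μ = conj (∫ x, conj (u x) * w t x ∂μ) := by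
    simp only [← integral_conj, map_mul, Complex.conj_conj, mul_comm]
  simp only [hconj, norm_mul, RCLike.norm_conj, sq]

end AverageKernel

section MeanSquare

variable {X Θ H ι : Type*} [MeasurableSpace X] [NormedAddCommGroup H] [InnerProductSpace ℂ H]
  [CompleteSpace H] {μ : Measure X} {v : ι → H}

theorem sum_norm_inner_adjoint_sq_le (hv : Orthonormal ℂ v) {W : Lp ℂ 2 μ →L[ℂ] H} (hW : ‖W‖ ≤ 1)
    (S : Finset ι) (g : Lp ℂ 2 μ) : ∑ n ∈ S, ‖⟪(W†) (v n), g⟫_ℂ‖ ^ 2 ≤ ‖g‖ ^ 2 := by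
  simp only [ContinuousLinearMap.adjoint_inner_left]
  refine (hv.sum_inner_products_le (W g)).trans ?_
  gcongr
  simpa using W.le_of_opNorm_le hW g

variable [IsProbabilityMeasure μ]

theorem sum_norm_inner_contraction_sq_le (hv : Orthonormal ℂ v) {W : Lp ℂ 2 μ →L[ℂ] H}
    (hW : ‖W‖ ≤ 1) {w : X → ℂ} (hw : ∀ x, ‖w x‖ = 1) (hwp : MemLp w 2 μ)
    (hWw : ‖W (hwp.toLp w)‖ = ‖hwp.toLp w‖) {A : Set X} (hA : MeasurableSet A) (S : Finset ι) :
    ∑ n ∈ S, ‖⟪v n, W (hwp.toLp w)⟫_ℂ‖ ^ 2 ≤ 1 - 3 / 4 * μ.real A +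
      (∑ n ∈ S, (∫ x in A, conj (w x) * (W†) (v n) x ∂μ) *
        ∫ x, conj ((W†) (v n) x) * w x ∂μ).re := by
  have hAp : MemLp (A.indicator w) 2 μ := hwp.indicator hA
  set e := hwp.toLp w
  set eA := hAp.toLp (A.indicator w)
  have hinner : ∀ g : Lp ℂ 2 μ, ⟪eA, g⟫_ℂ = ∫ x in A, conj (w x) * g x ∂μ := fun g => by
    rw [inner_Lp_eq_integral hAp.coeFn_toLp EventuallyEq.rfl, ← integral_indicator hA]
    congr with x
    by_cases hx : x ∈ A <;> simp [hx]
  have heA : ‖eA‖ ^ 2 = μ.real A := by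
    rw [norm_toLp_sq, ← integral_indicator_one hA]
    congr with x
    by_cases hx : x ∈ A <;> simp [hx, hw]
  have he : ‖e‖ ^ 2 = 1 := by rw [norm_toLp_sq]; simp [hw]
  have hcross : ⟪W eA, W e⟫_ℂ = μ.real A := by
    rw [← ContinuousLinearMap.adjoint_inner_right, adjoint_apply_self_of_norm_eq hW hWw,
      inner_Lp_eq_integral hAp.coeFn_toLp hwp.coeFn_toLp, ← integral_indicator_one hA,
      ← integral_complex_ofReal]
    congr with x
    by_cases hx : x ∈ A <;> simp [hx, hw, Complex.conj_mul']
  have hWeA : ‖W eA‖ ^ 2 ≤ μ.real A := by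
    rw [← heA]
    gcongr
    simpa using W.le_of_opNorm_le hW eA
  have hterm : ∀ n, ⟪W eA, v n⟫_ℂ * ⟪v n, W e⟫_ℂ =
      (∫ x in A, conj (w x) * (W†) (v n) x ∂μ) * ∫ x, conj ((W†) (v n) x) * w x ∂μ := fun n => by
    rw [← ContinuousLinearMap.adjoint_inner_right, hinner, ← ContinuousLinearMap.adjoint_inner_left,
      inner_Lp_eq_integral EventuallyEq.rfl hwp.coeFn_toLp]
  have hkey := re_inner_sub_sum_le hv S (W eA) (W e)
  simp only [hcross, hterm, hWw, he, map_sub, RCLike.re_to_complex, Complex.ofReal_re] at hkey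
  linarith

variable [MeasurableSpace Θ] {ρ : Measure Θ} [IsProbabilityMeasure ρ]

theorem sum_integral_norm_inner_contraction_sq_le (hv : Orthonormal ℂ v) {W : Lp ℂ 2 μ →L[ℂ] H}
    (hW : ‖W‖ ≤ 1) {w : Θ → X → ℂ} (hwm : Measurable (Function.uncurry w))
    (hw : ∀ t x, ‖w t x‖ = 1) (hwp : ∀ t, MemLp (w t) 2 μ)
    (hWw : ∀ t, ‖W ((hwp t).toLp (w t))‖ = ‖(hwp t).toLp (w t)‖) {A : Set X} (hA : MeasurableSet A)
    (S : Finset ι) :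
    ∑ n ∈ S, ∫ t, ‖⟪v n, W ((hwp t).toLp (w t))⟫_ℂ‖ ^ 2 ∂ρ ≤ 1 - 3 / 4 * μ.real A +
      √(S.card * ∫ x in A, ∫ y, ‖averageKernel ρ w x y‖ ^ 2 ∂μ ∂μ) := by
  have hu : ∀ n, Integrable ((W†) (v n)) μ := fun n => (Lp.memLp _).integrable one_le_two
  have huc : ∀ n, Integrable (fun x => conj ((W†) (v n) x)) μ := fun n =>
    (LinearIsometryEquiv.integrable_comp_iff RCLike.conjLIE).2 (hu n)
  have hFubini := fun n => integral_mul_integral_eq_averageKernel (ρ := ρ) hwm hw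
    ((hu n).restrict (s := A)) (huc n)
  have hcoeff : ∀ n t, ⟪v n, W ((hwp t).toLp (w t))⟫_ℂ = ∫ x, conj ((W†) (v n) x) * w t x ∂μ :=
    fun n t => by
      rw [← ContinuousLinearMap.adjoint_inner_left,
        inner_Lp_eq_integral EventuallyEq.rfl (hwp t).coeFn_toLp]
  have hsq_int : ∀ n ∈ S, Integrable (fun t => ‖⟪v n, W ((hwp t).toLp (w t))⟫_ℂ‖ ^ 2) ρ :=
    fun n _ => by simpa only [hcoeff] using integrable_norm_integral_mul_sq hwm hw (hu n)
  have hcross_int := integrable_finsetSum S fun n _ => (hFubini n).1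
  rw [← integral_finsetSum S hsq_int]
  calc ∫ t, ∑ n ∈ S, ‖⟪v n, W ((hwp t).toLp (w t))⟫_ℂ‖ ^ 2 ∂ρ
      ≤ ∫ t, (1 - 3 / 4 * μ.real A + RCLike.re (∑ n ∈ S,
          (∫ x in A, conj (w t x) * (W†) (v n) x ∂μ) * ∫ x, conj ((W†) (v n) x) * w t x ∂μ)) ∂ρ :=
        integral_mono (integrable_finsetSum S hsq_int)
          ((integrable_const _).add hcross_int.re) fun t =>
            sum_norm_inner_contraction_sq_le hv hW (hw t) (hwp t) (hWw t) hA S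
    _ = 1 - 3 / 4 * μ.real A + RCLike.re (∑ n ∈ S, ∫ x in A, (W†) (v n) x *
          ∫ y, conj ((W†) (v n) y) * averageKernel ρ w x y ∂μ ∂μ) := by
        rw [integral_add (integrable_const _) hcross_int.re, integral_re hcross_int,
          integral_finsetSum S fun n _ => (hFubini n).1]
        simp only [(hFubini _).2, integral_const, probReal_univ, one_smul]
    _ ≤ _ := by
        gcongr
        exact (RCLike.re_le_norm _).trans (norm_sum_setIntegral_mul_kernel_le
          (stronglyMeasurable_averageKernel hwm) (norm_averageKernel_le_one hw)
          (sum_norm_inner_adjoint_sq_le hv hW S) A)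

theorem sum_integral_norm_inner_sq_le (hv : Orthonormal ℂ v) {w : Θ → X → ℂ}
    (hwm : Measurable (Function.uncurry w)) (hw : ∀ t x, ‖w t x‖ = 1) {ψ : Θ → H}
    (hψ : ∀ s t, ⟪ψ s, ψ t⟫_ℂ = ∫ x, conj (w s x) * w t x ∂μ) {A : Set X} (hA : MeasurableSet A)
    (S : Finset ι) :
    ∑ n ∈ S, ∫ t, ‖⟪v n, ψ t⟫_ℂ‖ ^ 2 ∂ρ ≤ 1 - 3 / 4 * μ.real A +
      √(S.card * ∫ x in A, ∫ y, ‖averageKernel ρ w x y‖ ^ 2 ∂μ ∂μ) := by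
  have hwp : ∀ t, MemLp (w t) 2 μ := fun t =>
    MemLp.of_bound hwm.of_uncurry_left.aestronglyMeasurable 1 (ae_of_all _ fun x => (hw t x).le)
  have hGram : ∀ s t, ⟪ψ s, ψ t⟫_ℂ = ⟪(hwp s).toLp (w s), (hwp t).toLp (w t)⟫_ℂ := fun s t => by
    rw [hψ, inner_Lp_eq_integral (hwp s).coeFn_toLp (hwp t).coeFn_toLp]
  obtain ⟨W, hW, hWψ⟩ := exists_contraction_of_inner_eq hGram
  have hnorm : ∀ t, ‖W ((hwp t).toLp (w t))‖ = ‖(hwp t).toLp (w t)‖ := fun t => by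
    rw [hWψ, norm_eq_sqrt_re_inner (𝕜 := ℂ), norm_eq_sqrt_re_inner (𝕜 := ℂ), hGram]
  simpa only [hWψ] using
    sum_integral_norm_inner_contraction_sq_le (ρ := ρ) hv hW hwm hw hwp hnorm hA S

end MeanSquare

section PoissonKernel

/-- The Poisson kernel `ε / ((x - E) ^ 2 + ε ^ 2)` of the upper half plane at `E + iε`, normalized
to have mass `π` so that its integral against a measure is the imaginary part of the Borel
transform. -/
noncomputable def poisson (ε E x : ℝ) : ℝ := ε / ((x - E) ^ 2 + ε ^ 2)

/-- The correlation integral `∫_A μ(B(x, r)) dμ(x)` of `μ` over `A` at scale `r`, with the indicator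
of the ball smoothed to `r ^ 2 / (r ^ 2 + |y - x| ^ 2)`. -/
noncomputable def correlationIntegral (μ : Measure ℝ) (A : Set ℝ) (r : ℝ) : ℝ :=
  ∫ x in A, ∫ y, r ^ 2 / (r ^ 2 + (y - x) ^ 2) ∂μ ∂μ

variable {ε : ℝ}

theorem poisson_nonneg (hε : 0 < ε) (E x : ℝ) : 0 ≤ poisson ε E x := by
  unfold poisson; positivity

theorem poisson_le_inv (hε : 0 < ε) (E x : ℝ) : poisson ε E x ≤ ε⁻¹ := by
  rw [poisson, inv_eq_one_div, div_le_div_iff₀ (by positivity) hε]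
  nlinarith [sq_nonneg (x - E)]

theorem norm_poisson_le_inv (hε : 0 < ε) (E x : ℝ) : ‖poisson ε E x‖ ≤ ε⁻¹ := by
  rw [Real.norm_of_nonneg (poisson_nonneg hε E x)]
  exact poisson_le_inv hε E x

theorem continuous_poisson (hε : 0 < ε) : Continuous fun z : ℝ × ℝ => poisson ε z.1 z.2 := by
  unfold poisson
  exact continuous_const.div (by fun_prop) fun z => by positivity

theorem integrable_poisson_center (hε : 0 < ε) (x : ℝ) : Integrable fun E => poisson ε E x := by
  have h := ((integrable_inv_one_add_sq.comp_div hε.ne').comp_sub_left x).const_mul ε⁻¹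
  refine h.congr (ae_of_all _ fun E => ?_)
  simp only [poisson]
  field_simp
  ring

theorem integral_poisson_center (ε x : ℝ) : ∫ E, poisson ε E x = ∫ y, poisson ε 0 y := by
  rw [← integral_sub_left_eq_self (poisson ε 0) volume x]
  simp only [poisson, sub_zero]

variable {μ : Measure ℝ} [IsFiniteMeasure μ]

theorem integrable_poisson (hε : 0 < ε) (E : ℝ) : Integrable (poisson ε E) μ :=
  have hcont : Continuous (poisson ε E) := (continuous_poisson hε).comp (Continuous.prodMk_right E)
  Integrable.of_bound hcont.aestronglyMeasurable ε⁻¹ (ae_of_all _ (norm_poisson_le_inv hε E))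

theorem integrable_integral_poisson (hε : 0 < ε) : Integrable fun E => ∫ x, poisson ε E x ∂μ := by
  have h : Integrable (Function.uncurry (poisson ε)) (volume.prod μ) := by
    refine (integrable_prod_iff' (continuous_poisson hε).aestronglyMeasurable).2
      ⟨ae_of_all _ (integrable_poisson_center hε), ?_⟩
    simp only [Real.norm_of_nonneg (poisson_nonneg hε _ _), integral_poisson_center,
      integrable_const]
  exact h.integral_prod_left

theorem integrable_mul_integral_poisson {f : ℝ → ℝ} {ν : Measure ℝ} (hε : 0 < ε)
    (hf : Integrable f ν) : Integrable (fun E => f E * ∫ x, poisson ε E x ∂μ) ν := by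
  refine hf.mul_bdd (c := ε⁻¹ * μ.real Set.univ) ?_ (ae_of_all _ fun E =>
    norm_integral_le_of_norm_le_const (ae_of_all _ (norm_poisson_le_inv hε E)))
  exact (continuous_poisson hε).stronglyMeasurable.integral_prod_right.aestronglyMeasurable

theorem integral_mul_poisson_swap {f : ℝ → ℝ} {ν : Measure ℝ} [SFinite ν] (hε : 0 < ε)
    (hf : Integrable f ν) :
    Integrable (fun x => ∫ E, f E * poisson ε E x ∂ν) μ ∧
    ∫ x, ∫ E, f E * poisson ε E x ∂ν ∂μ = ∫ E, f E * ∫ x, poisson ε E x ∂μ ∂ν := by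
  have h : Integrable (Function.uncurry fun x E => f E * poisson ε E x) (μ.prod ν) :=
    (hf.comp_snd μ).mul_bdd (c := ε⁻¹)
      ((continuous_poisson hε).comp continuous_swap).aestronglyMeasurable
      (ae_of_all _ fun z => norm_poisson_le_inv hε z.2 z.1)
  refine ⟨h.integral_prod_left, ?_⟩
  simp only [integral_integral_swap h, integral_const_mul]

theorem sq_div_sq_add_sq_le_poisson_mul_poisson (hε : 0 < ε) {E x : ℝ} (hE : |E - x| ≤ ε) (y : ℝ) :
    (2 * ε) ^ 2 / ((2 * ε) ^ 2 + (y - x) ^ 2) ≤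
      16 * ε ^ 2 * (poisson ε E x * poisson ε E y) := by
  have hEx : (E - x) ^ 2 ≤ ε ^ 2 := sq_le_sq' (abs_le.1 hE).1 (abs_le.1 hE).2
  have hx : 1 / (2 * ε) ≤ poisson ε E x := by
    rw [poisson, div_le_div_iff₀ (by positivity) (by positivity)]
    nlinarith
  have hy : ε / (3 * ε ^ 2 + 2 * (y - x) ^ 2) ≤ poisson ε E y := by
    refine div_le_div_of_nonneg_left hε.le (by positivity) ?_
    nlinarith [sq_nonneg (y - x + (E - x))]
  calc (2 * ε) ^ 2 / ((2 * ε) ^ 2 + (y - x) ^ 2)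
      ≤ 8 * ε ^ 2 / (3 * ε ^ 2 + 2 * (y - x) ^ 2) := by
        rw [div_le_div_iff₀ (by positivity) (by positivity)]
        nlinarith [pow_pos hε 4]
    _ = 16 * ε ^ 2 * (1 / (2 * ε) * (ε / (3 * ε ^ 2 + 2 * (y - x) ^ 2))) := by field_simp; norm_num
    _ ≤ 16 * ε ^ 2 * (poisson ε E x * poisson ε E y) := by
        gcongr
        exact poisson_nonneg hε E x

theorem integrable_sq_div_sq_add_sq {r : ℝ} (hr : 0 < r) (x : ℝ) :
    Integrable (fun y => r ^ 2 / (r ^ 2 + (y - x) ^ 2)) μ := by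
  have hcont : Continuous fun y => r ^ 2 / (r ^ 2 + (y - x) ^ 2) :=
    continuous_const.div (by fun_prop) fun y => by positivity
  refine Integrable.of_bound hcont.aestronglyMeasurable 1 (ae_of_all _ fun y => ?_)
  rw [Real.norm_of_nonneg (by positivity)]
  exact div_le_one_of_le₀ (by nlinarith [sq_nonneg (y - x)]) (by positivity)

theorem integral_sq_div_sq_add_sq_le (hε : 0 < ε) {A : Set ℝ} {x : ℝ} (hx : x ∈ A) :
    ∫ y, (2 * ε) ^ 2 / ((2 * ε) ^ 2 + (y - x) ^ 2) ∂μ ≤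
      8 * ε * ∫ E in Metric.thickening (2 * ε) A, (∫ y, poisson ε E y ∂μ) * poisson ε E x := by
  set κ := ∫ y, (2 * ε) ^ 2 / ((2 * ε) ^ 2 + (y - x) ^ 2) ∂μ
  have hball : Metric.ball x ε ⊆ Metric.thickening (2 * ε) A := fun E hE =>
    Metric.mem_thickening_iff.2 ⟨x, hx, (Metric.mem_ball.1 hE).trans (by linarith)⟩
  have hlow : ∀ E ∈ Metric.ball x ε,
      κ / (16 * ε ^ 2) ≤ (∫ y, poisson ε E y ∂μ) * poisson ε E x := fun E hE => by
    rw [div_le_iff₀' (by positivity), mul_comm (∫ y, _ ∂μ), ← integral_const_mul,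
      ← integral_const_mul]
    exact integral_mono (integrable_sq_div_sq_add_sq (by positivity) x)
      (((integrable_poisson hε E).const_mul _).const_mul _)
      (sq_div_sq_add_sq_le_poisson_mul_poisson hε (Metric.mem_ball.1 hE).le)
  have hint : Integrable fun E => (∫ y, poisson ε E y ∂μ) * poisson ε E x :=
    (integrable_integral_poisson hε).mul_bdd
      (integrable_poisson_center hε x).aestronglyMeasurable
      (ae_of_all _ fun E => norm_poisson_le_inv hε E x)
  calc κ = 8 * ε * (κ / (16 * ε ^ 2) * volume.real (Metric.ball x ε)) := by
        rw [Real.volume_real_ball hε.le]; field_simp; ring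
    _ ≤ 8 * ε * ∫ E in Metric.ball x ε, (∫ y, poisson ε E y ∂μ) * poisson ε E x := by
        gcongr
        exact setIntegral_ge_of_const_le_real measurableSet_ball measure_ball_lt_top.ne hlow
          hint.integrableOn
    _ ≤ _ := by
        refine mul_le_mul_of_nonneg_left (setIntegral_mono_set hint.integrableOn
          (ae_of_all _ fun E => ?_) hball.eventuallyLE) (by positivity)
        exact mul_nonneg (integral_nonneg (poisson_nonneg hε E)) (poisson_nonneg hε E x)

theorem correlationIntegral_le (hε : 0 < ε) {A : Set ℝ} (hA : MeasurableSet A) :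
    correlationIntegral μ A (2 * ε) ≤
      8 * (ε * ∫ E in Metric.thickening (2 * ε) A, (∫ x, poisson ε E x ∂μ) ^ 2) := by
  have hq : IntegrableOn (fun E => ∫ y, poisson ε E y ∂μ) (Metric.thickening (2 * ε) A) :=
    (integrable_integral_poisson hε).integrableOn
  have hswap := integral_mul_poisson_swap (μ := μ.restrict A) hε hq
  have hle : ∀ E, ∫ x in A, poisson ε E x ∂μ ≤ ∫ x, poisson ε E x ∂μ := fun E =>
    setIntegral_le_integral (integrable_poisson hε E) (ae_of_all _ (poisson_nonneg hε E))
  calc correlationIntegral μ A (2 * ε)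
      ≤ ∫ x in A, 8 * ε * (∫ E in Metric.thickening (2 * ε) A,
          (∫ y, poisson ε E y ∂μ) * poisson ε E x) ∂μ :=
        integral_mono_of_nonneg (ae_of_all _ fun x => by positivity) (hswap.1.const_mul _)
          ((ae_restrict_mem hA).mono fun x hx => integral_sq_div_sq_add_sq_le hε hx)
    _ = 8 * (ε * ∫ E in Metric.thickening (2 * ε) A,
          (∫ y, poisson ε E y ∂μ) * ∫ x in A, poisson ε E x ∂μ) := by
        rw [integral_const_mul, hswap.2, mul_assoc]
    _ ≤ _ := by
        simp only [sq]
        gcongr 8 * (ε * ?_)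
        exact integral_mono (integrable_mul_integral_poisson hε hq)
          (integrable_mul_integral_poisson hε hq) fun E =>
            mul_le_mul_of_nonneg_left (hle E) (integral_nonneg (poisson_nonneg hε E))

end PoissonKernel

section ExponentialTime

/-- The plane wave `e ^ {-itx}` of energy `x` at time `t`. -/
noncomputable def wave (t x : ℝ) : ℂ := Complex.exp (-Complex.I * t * x)

theorem norm_wave (t x : ℝ) : ‖wave t x‖ = 1 := by
  have h : -Complex.I * t * x = ((-(t * x) : ℝ) : ℂ) * Complex.I := by push_cast; ring
  rw [wave, h, Complex.norm_exp_ofReal_mul_I]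

theorem measurable_wave : Measurable (Function.uncurry wave) := by
  unfold wave; fun_prop

theorem conj_wave_mul_wave (s t x y : ℝ) :
    conj (wave s x) * wave t y = Complex.exp (-Complex.I * (t * y - s * x)) := by
  rw [wave, wave, ← Complex.exp_conj, ← Complex.exp_add]
  simp only [map_mul, map_neg, Complex.conj_I, Complex.conj_ofReal]
  ring_nf

open ProbabilityTheory

variable {r : ℝ}

theorem integral_expMeasure {G : Type*} [NormedAddCommGroup G] [NormedSpace ℝ G] (hr : 0 < r)
    (f : ℝ → G) :
    ∫ t, f t ∂(expMeasure r) = r • ∫ t in Set.Ioi (0 : ℝ), Real.exp (-(r * t)) • f t := by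
  have hpdf : ∀ t, (exponentialPDF r t).toReal • f t =
      (Set.Ici 0).indicator (fun t => r • Real.exp (-(r * t)) • f t) t := fun t => by
    rw [exponentialPDF_eq, ENNReal.toReal_ofReal (by positivity), Set.indicator_apply]
    by_cases ht : 0 ≤ t <;> simp [ht, mul_smul]
  have hm : Measurable (exponentialPDF r) :=
    (measurable_exponentialPDFReal r).ennreal_ofReal
  change ∫ t, f t ∂(volume.withDensity (exponentialPDF r)) = _
  rw [integral_withDensity_eq_integral_toReal_smul hm (ae_of_all _ fun t => ENNReal.ofReal_lt_top)]
  simp only [hpdf]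
  rw [integral_indicator measurableSet_Ici, integral_Ici_eq_integral_Ioi, integral_smul]

theorem averageKernel_expMeasure_wave (hr : 0 < r) (x y : ℝ) :
    averageKernel (expMeasure r) wave x y = r / (r + Complex.I * (y - x)) := by
  have hexp : ∀ t : ℝ, Real.exp (-(r * t)) • (conj (wave t x) * wave t y) =
      Complex.exp (-(r + Complex.I * (y - x)) * t) := fun t => by
    rw [conj_wave_mul_wave, Complex.real_smul, Complex.ofReal_exp, ← Complex.exp_add]
    congr 1; push_cast; ring
  rw [averageKernel, integral_expMeasure hr]
  simp only [hexp]
  rw [integral_exp_mul_complex_Ioi (by simpa using hr), Complex.real_smul]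
  simp only [Complex.ofReal_zero, mul_zero, Complex.exp_zero, neg_div_neg_eq, mul_one_div]

theorem norm_sq_averageKernel_expMeasure_wave (hr : 0 < r) (x y : ℝ) :
    ‖averageKernel (expMeasure r) wave x y‖ ^ 2 = r ^ 2 / (r ^ 2 + (y - x) ^ 2) := by
  rw [averageKernel_expMeasure_wave hr, norm_div, div_pow, ← Complex.normSq_eq_norm_sq,
    ← Complex.normSq_eq_norm_sq, Complex.normSq_apply, Complex.normSq_apply]
  simp [sq]

theorem re_averageKernel_expMeasure_wave (hr : 0 < r) (x y : ℝ) :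
    (averageKernel (expMeasure r) wave x y).re = r ^ 2 / (r ^ 2 + (y - x) ^ 2) := by
  rw [averageKernel_expMeasure_wave hr, Complex.div_re, Complex.normSq_apply]
  simp [sq]

variable {μ : Measure ℝ} [IsFiniteMeasure μ]

theorem integral_norm_sq_integral_wave (hr : 0 < r) :
    ∫ t, ‖∫ x, wave t x ∂μ‖ ^ 2 ∂(expMeasure r) = correlationIntegral μ Set.univ r := by
  have := isProbabilityMeasure_expMeasure hr
  obtain ⟨hint, hswap⟩ := integral_mul_integral_eq_averageKernel (ρ := expMeasure r)
    measurable_wave norm_wave (integrable_const (μ := μ) (1 : ℂ)) (integrable_const (μ := μ) 1)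
  simp only [mul_one, one_mul, integral_conj] at hint hswap
  have hR := stronglyMeasurable_averageKernel (ρ := expMeasure r) measurable_wave
  have hRle : ∀ x y, ‖averageKernel (expMeasure r) wave x y‖ ≤ 1 :=
    norm_averageKernel_le_one norm_wave
  have hR₁ : ∀ x, Integrable (averageKernel (expMeasure r) wave x) μ := fun x =>
    Integrable.of_bound (hR.comp_measurable measurable_prodMk_left).aestronglyMeasurable 1
      (ae_of_all _ (hRle x))
  have hR₂ : Integrable (fun x => ∫ y, averageKernel (expMeasure r) wave x y ∂μ) μ :=
    (Integrable.of_bound hR.aestronglyMeasurable 1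
      (ae_of_all (μ.prod μ) fun z => hRle z.1 z.2)).integral_prod_left
  have hsq : ∀ t, ‖∫ x, wave t x ∂μ‖ ^ 2 =
      RCLike.re (conj (∫ x, wave t x ∂μ) * ∫ x, wave t x ∂μ) := fun t => by
    rw [RCLike.conj_mul, ← RCLike.ofReal_pow, RCLike.ofReal_re]
  simp only [hsq]
  rw [integral_re hint, hswap, ← integral_re hR₂, correlationIntegral, Measure.restrict_univ]
  simp only [← integral_re (hR₁ _), RCLike.re_to_complex, re_averageKernel_expMeasure_wave hr]

end ExponentialTime

section Dynamics

theorem IsEvolution.inner_add {d : Domain} {V : d.sites → ℝ} {ψ : ℝ → d.ell2}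
    (hψ : IsEvolution V ψ) (r s : ℝ) : ⟪ψ s, ψ (s + r)⟫_ℂ = ψ r d.one := by
  have hderiv : ∀ t, HasDerivAt (fun t => ⟪ψ t, ψ (t + r)⟫_ℂ) 0 t := fun t => by
    obtain ⟨hdom₁, hderiv₁⟩ := hψ.2 t
    obtain ⟨hdom₂, hderiv₂⟩ := hψ.2 (t + r)
    refine (hderiv₁.inner ℂ (hderiv₂.comp_add_const t r)).congr_deriv ?_
    rw [inner_smul_left, inner_smul_right, hamiltonian_symm V ⟨ψ t, hdom₁⟩ ⟨ψ (t + r), hdom₂⟩]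
    simp
  have hconst := is_const_of_deriv_eq_zero (fun t => (hderiv t).differentiableAt)
    (fun t => (hderiv t).deriv) s 0
  simp only [zero_add, hψ.1] at hconst
  rw [hconst, delta, lp.inner_single_left]
  simp

variable {d : Domain} (V : d.sites → ℝ)

instance isProbabilityMeasure_spectralMeasure : IsProbabilityMeasure (spectralMeasure V) :=
  (spectralMeasure_spec V).1

theorem evolution_apply_one (t : ℝ) :
    evolution V t d.one = ∫ x, wave t x ∂(spectralMeasure V) :=
  (spectralMeasure_spec V).2.1 t

theorem inner_evolution (s t : ℝ) : ⟪evolution V s, evolution V t⟫_ℂ =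
    ∫ x, conj (wave s x) * wave t x ∂(spectralMeasure V) := by
  have h := (evolution_spec V).inner_add (t - s) s
  rw [add_sub_cancel, evolution_apply_one] at h
  rw [h]
  congr with x
  rw [conj_wave_mul_wave, wave]
  congr 1; push_cast; ring

theorem norm_evolution (t : ℝ) : ‖evolution V t‖ = 1 := by
  have h : ‖evolution V t‖ ^ 2 = 1 := by
    rw [← inner_self_eq_norm_sq (𝕜 := ℂ), inner_evolution]
    simp [Complex.conj_mul', norm_wave]
  exact (pow_eq_one_iff_of_nonneg (norm_nonneg _) two_ne_zero).1 h

theorem hasSum_norm_sq_evolution (t : ℝ) : HasSum (fun n => ‖evolution V t n‖ ^ 2) 1 := by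
  simpa [norm_evolution] using lp.hasSum_norm (p := 2) (by simp) (evolution V t)

theorem norm_sq_evolution_apply_le (t : ℝ) (n : d.sites) : ‖evolution V t n‖ ^ 2 ≤ 1 :=
  le_hasSum (hasSum_norm_sq_evolution V t) n fun _ _ => sq_nonneg _

theorem inner_single_one {ι : Type*} [DecidableEq ι] (n : ι) (f : lp (fun _ : ι => ℂ) 2) :
    ⟪lp.single 2 n (1 : ℂ), f⟫_ℂ = f n := by
  simp [lp.inner_single_left]

theorem orthonormal_single_one {ι : Type*} [DecidableEq ι] :
    Orthonormal ℂ fun n : ι => (lp.single 2 n (1 : ℂ) : lp (fun _ : ι => ℂ) 2) := by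
  rw [orthonormal_iff_ite]
  intro m n
  rw [inner_single_one, lp.coeFn_single, Pi.single_apply]

theorem continuous_evolution : Continuous (evolution V) :=
  continuous_iff_continuousAt.2 fun t => ((evolution_spec V).2 t).2.continuousAt

theorem continuous_norm_sq_evolution_apply (n : d.sites) :
    Continuous fun t => ‖evolution V t n‖ ^ 2 := by
  classical
  have h : Continuous fun t => ⟪lp.single 2 n (1 : ℂ), evolution V t⟫_ℂ :=
    continuous_const.inner (continuous_evolution V)
  simp only [inner_single_one] at h
  exact h.norm.pow 2

variable {T : ℝ}

theorem avgProb_eq_integral (hT : 0 < T) (n : d.sites) :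
    avgProb V n T = ∫ t, ‖evolution V t n‖ ^ 2 ∂(ProbabilityTheory.expMeasure (2 / T)) := by
  rw [integral_expMeasure (by positivity)]
  simp only [avgProb, smul_eq_mul, neg_mul, neg_div, div_mul_eq_mul_div]

theorem avgProb_nonneg (hT : 0 < T) (n : d.sites) : 0 ≤ avgProb V n T := by
  rw [avgProb_eq_integral V hT]
  positivity

theorem tsum_ofReal_avgProb (hT : 0 < T) : ∑' n, ENNReal.ofReal (avgProb V n T) = 1 := by
  have := ProbabilityTheory.isProbabilityMeasure_expMeasure (r := 2 / T) (by positivity)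
  have hint : ∀ n, Integrable (fun t => ‖evolution V t n‖ ^ 2)
      (ProbabilityTheory.expMeasure (2 / T)) := fun n =>
    Integrable.of_bound (continuous_norm_sq_evolution_apply V n).aestronglyMeasurable 1
      (ae_of_all _ fun t => by simpa using norm_sq_evolution_apply_le V t n)
  have hsum : ∀ t, ∑' n, ENNReal.ofReal (‖evolution V t n‖ ^ 2) = 1 := fun t => by
    rw [← ENNReal.ofReal_tsum_of_nonneg (fun n => sq_nonneg _)
      (hasSum_norm_sq_evolution V t).summable, (hasSum_norm_sq_evolution V t).tsum_eq,
      ENNReal.ofReal_one]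
  simp only [avgProb_eq_integral V hT,
    ofReal_integral_eq_lintegral_ofReal (hint _) (ae_of_all _ fun _ => sq_nonneg _)]
  rw [← lintegral_tsum fun n => (continuous_norm_sq_evolution_apply V n).measurable.ennreal_ofReal
    |>.aemeasurable]
  simp only [hsum, lintegral_const, measure_univ, mul_one]

theorem hasSum_avgProb (hT : 0 < T) : HasSum (fun n => avgProb V n T) 1 := by
  have h := ENNReal.hasSum_toReal (f := fun n => ENNReal.ofReal (avgProb V n T))
    (by simp [tsum_ofReal_avgProb V hT])
  rw [← ENNReal.tsum_toReal_eq fun n => ENNReal.ofReal_ne_top, tsum_ofReal_avgProb V hT] at h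
  simpa [ENNReal.toReal_ofReal, avgProb_nonneg V hT] using h

theorem avgProb_le_moment (p : ℝ) : ENNReal.ofReal (avgProb V d.one T) ≤ moment V p T := by
  simpa [Domain.one, moment] using
    ENNReal.le_tsum (f := fun n : d.sites => ENNReal.ofReal (|((n : ℤ) : ℝ)| ^ p * avgProb V n T))
      d.one

theorem le_moment {p r : ℝ} (hT : 0 < T) (hr₀ : 0 ≤ r) (S : Finset d.sites)
    (hr : ∀ n ∉ S, r ≤ |((n : ℤ) : ℝ)| ^ p) :
    ENNReal.ofReal (r * (1 - ∑ n ∈ S, avgProb V n T)) ≤ moment V p T := by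
  have hcompl : HasSum (fun n : {n // n ∉ S} => avgProb V n T) (1 - ∑ n ∈ S, avgProb V n T) := by
    rw [Finset.hasSum_compl_iff (f := fun n => avgProb V n T), sub_add_cancel]
    exact hasSum_avgProb V hT
  have htail := hcompl.mul_left r
  calc ENNReal.ofReal (r * (1 - ∑ n ∈ S, avgProb V n T))
      = ∑' n : {n // n ∉ S}, ENNReal.ofReal (r * avgProb V n T) := by
        rw [← htail.tsum_eq]
        exact ENNReal.ofReal_tsum_of_nonneg
          (fun n => mul_nonneg hr₀ (avgProb_nonneg V hT _)) htail.summable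
    _ ≤ ∑' n : {n // n ∉ S}, ENNReal.ofReal (|((n : ℤ) : ℝ)| ^ p * avgProb V n T) :=
        ENNReal.tsum_le_tsum fun n => ENNReal.ofReal_le_ofReal
          (mul_le_mul_of_nonneg_right (hr n n.2) (avgProb_nonneg V hT n))
    _ ≤ moment V p T := ENNReal.tsum_comp_le_tsum_of_injective Subtype.val_injective
        fun n : d.sites => ENNReal.ofReal (|((n : ℤ) : ℝ)| ^ p * avgProb V n T)

theorem exists_finset_card_le_of_one_le (d : Domain) {ν : ℝ} (hν : 1 ≤ ν) :
    ∃ S : Finset d.sites, (S.card : ℝ) ≤ ν ∧ ∀ n ∉ S, ν / 3 ≤ |((n : ℤ) : ℝ)| := by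
  classical
  set k := ⌊(ν - 1) / 2⌋₊
  have hk_le : (k : ℝ) ≤ (ν - 1) / 2 := Nat.floor_le (by linarith)
  have hk_lt : (ν - 1) / 2 < k + 1 := Nat.lt_floor_add_one _
  refine ⟨(Finset.Icc (-(k : ℤ)) k).subtype (· ∈ d.sites), ?_, fun n hn => ?_⟩
  · have hcard : ((Finset.Icc (-(k : ℤ)) k).subtype (· ∈ d.sites)).card ≤ 2 * k + 1 := by
      rw [Finset.card_subtype]
      refine (Finset.card_filter_le _ _).trans ?_
      rw [Int.card_Icc]
      omega
    have hcard' : (((Finset.Icc (-(k : ℤ)) k).subtype (· ∈ d.sites)).card : ℝ) ≤ 2 * k + 1 :=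
      mod_cast hcard
    linarith
  · rw [Finset.mem_subtype, Finset.mem_Icc, ← abs_le, not_le, ← Int.add_one_le_iff] at hn
    have hn' : (k : ℝ) + 1 ≤ |((n : ℤ) : ℝ)| := mod_cast hn
    linarith [k.cast_nonneg (α := ℝ)]

theorem sum_avgProb_le (hT : 0 < T) {A : Set ℝ} (hA : MeasurableSet A) (S : Finset d.sites) :
    ∑ n ∈ S, avgProb V n T ≤ 1 - 3 / 4 * (spectralMeasure V).real A +
      √(S.card * correlationIntegral (spectralMeasure V) A (2 / T)) := by
  classical
  have hr : 0 < 2 / T := by positivity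
  have := ProbabilityTheory.isProbabilityMeasure_expMeasure hr
  simpa only [inner_single_one, ← avgProb_eq_integral V hT, correlationIntegral,
    norm_sq_averageKernel_expMeasure_wave hr] using
    sum_integral_norm_inner_sq_le (ρ := ProbabilityTheory.expMeasure (2 / T))
      orthonormal_single_one measurable_wave norm_wave (inner_evolution V) hA S

theorem le_moment_of_mul_correlationIntegral_le {p ν : ℝ} (hp : 0 < p) (hT : 0 < T) {A : Set ℝ}
    (hA : MeasurableSet A) (hν : 1 ≤ ν)
    (hcorr : ν * correlationIntegral (spectralMeasure V) A (2 / T) ≤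
      (spectralMeasure V).real A ^ 2 / 4) :
    ENNReal.ofReal ((ν / 3) ^ p * ((spectralMeasure V).real A / 4)) ≤ moment V p T := by
  set m := (spectralMeasure V).real A
  obtain ⟨S, hcard, hfar⟩ := exists_finset_card_le_of_one_le d hν
  have hcorr₀ : 0 ≤ correlationIntegral (spectralMeasure V) A (2 / T) := by
    unfold correlationIntegral; positivity
  have hsqrt : √(S.card * correlationIntegral (spectralMeasure V) A (2 / T)) ≤ m / 2 := by
    refine Real.sqrt_le_iff.2 ⟨by positivity, ?_⟩
    nlinarith [mul_le_mul_of_nonneg_right hcard hcorr₀]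
  have hmass : m / 4 ≤ 1 - ∑ n ∈ S, avgProb V n T := by linarith [sum_avgProb_le V hT hA S]
  refine le_trans (ENNReal.ofReal_le_ofReal ?_) (le_moment V hT (by positivity : 0 ≤ (ν / 3) ^ p) S
    fun n hn => Real.rpow_le_rpow (by positivity) (hfar n hn) hp.le)
  gcongr

theorem avgProb_one_eq_correlationIntegral (hT : 0 < T) :
    avgProb V d.one T = correlationIntegral (spectralMeasure V) Set.univ (2 / T) := by
  simp only [avgProb_eq_integral V hT, evolution_apply_one]
  exact integral_norm_sq_integral_wave (by positivity)

theorem one_third_rpow_div_four_le_moment {p : ℝ} (hp : 0 < p) (hT : 0 < T) :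
    ENNReal.ofReal ((1 / 3) ^ p / 4) ≤ moment V p T := by
  rcases le_or_gt (avgProb V d.one T) (1 / 4) with hsmall | hlarge
  · have h := le_moment_of_mul_correlationIntegral_le V hp hT MeasurableSet.univ le_rfl
      (by simpa [← avgProb_one_eq_correlationIntegral V hT] using hsmall)
    simpa [div_eq_mul_inv] using h
  · refine le_trans (ENNReal.ofReal_le_ofReal ?_) (avgProb_le_moment V p)
    linarith [Real.rpow_le_one (x := 1 / 3) (by norm_num) (by norm_num) hp.le]

theorem im_borelTransform {ε : ℝ} (hε : 0 < ε) (E : ℝ) :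
    (borelTransform V (E + Complex.I * ε)).im = ∫ x, poisson ε E x ∂(spectralMeasure V) := by
  have him : ∀ x : ℝ, ((x : ℂ) - (E + Complex.I * ε)).im = -ε := fun x => by simp
  have hne : ∀ x : ℝ, (x : ℂ) - (E + Complex.I * ε) ≠ 0 := fun x h => by
    simpa [h, hε.ne'] using him x
  have hint : Integrable (fun x : ℝ => 1 / ((x : ℂ) - (E + Complex.I * ε)))
      (spectralMeasure V) := by
    refine Integrable.of_bound (continuous_const.div (by fun_prop) hne).aestronglyMeasurable
      (1 / ε) (ae_of_all _ fun x => ?_)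
    rw [norm_div, norm_one]
    refine one_div_le_one_div_of_le hε ?_
    simpa only [him, abs_neg, abs_of_pos hε] using
      Complex.abs_im_le_norm ((x : ℂ) - (E + Complex.I * ε))
  rw [borelTransform, ← RCLike.im_eq_complex_im, ← integral_im hint]
  congr with x
  rw [RCLike.im_eq_complex_im, one_div, Complex.inv_im, Complex.normSq_apply]
  simp [poisson, sq]

theorem correlationIntegral_spectralMeasure_le (hT : 0 < T) {A : Set ℝ} (hA : MeasurableSet A) :
    correlationIntegral (spectralMeasure V) A (2 / T) ≤
      8 * energyIntegral V (Metric.thickening (2 * (1 / T)) A) (1 / T) := by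
  have hε : 0 < 1 / T := by positivity
  simpa only [energyIntegral, im_borelTransform V hε, mul_one_div] using
    correlationIntegral_le (μ := spectralMeasure V) hε hA

theorem rpow_mul_rpow_le_of_div_rpow_mul_le {p a b X : ℝ} (hp : 0 < p) (ha : 0 ≤ a) (hb : 0 ≤ b)
    (hX : 0 < X) (h : (a / X) ^ p * b ≤ X) : a ^ (p / (p + 1)) * b ^ (1 / (p + 1)) ≤ X := by
  have hp₁ : 0 < p + 1 := by linarith
  rw [← Real.rpow_le_rpow_iff (by positivity) hX.le hp₁,
    Real.mul_rpow (by positivity) (by positivity), ← Real.rpow_mul ha, ← Real.rpow_mul hb,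
    div_mul_cancel₀ _ hp₁.ne', div_mul_cancel₀ _ hp₁.ne', Real.rpow_one]
  calc a ^ p * b = X ^ p * ((a / X) ^ p * b) := by
        rw [← mul_assoc, ← Real.mul_rpow hX.le (by positivity), mul_div_cancel₀ _ hX.ne']
    _ ≤ X ^ p * X := by gcongr
    _ = X ^ (p + 1) := (Real.rpow_add_one hX.ne' p).symm

/-- The constant `C_p` of the lower bound on the moment. The `1 / 96 = 1 / 3 * (1 / 32)` comes from
taking about `ν = m ^ 2 * g / (32 * X)` sites within distance `ν / 3` of the origin, where `m` is
the measure of `A` and `X` the moment; the `1 / 4` is the fraction of `m` lying farther out. -/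
noncomputable def momentConst (p : ℝ) : ℝ := (1 / 96) ^ (p / (p + 1)) * (1 / 4) ^ (1 / (p + 1))

theorem momentConst_pos (p : ℝ) : 0 < momentConst p := by
  unfold momentConst; positivity

theorem momentConst_mul_rpow_mul_rpow {p g m : ℝ} (hp : 0 < p) (hg : 0 ≤ g) (hm : 0 ≤ m) :
    momentConst p * g ^ (p / (p + 1)) * m ^ ((1 + 2 * p) / (p + 1)) =
      (m ^ 2 * g / 96) ^ (p / (p + 1)) * (m / 4) ^ (1 / (p + 1)) := by
  have hexp : (1 + 2 * p) / (p + 1) = 2 * (p / (p + 1)) + 1 / (p + 1) := by ring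
  rw [hexp, Real.rpow_add_of_nonneg hm (by positivity) (by positivity), Real.rpow_mul hm,
    Real.rpow_two, div_eq_mul_one_div (m ^ 2 * g), div_eq_mul_one_div m,
    Real.mul_rpow (by positivity) (by norm_num), Real.mul_rpow (by positivity) hg,
    Real.mul_rpow hm (by norm_num), momentConst]
  ring

theorem div_rpow_mul_le_of_energyIntegral_le {p : ℝ} (hp : 0 < p) (hT : 0 < T) {A : Set ℝ}
    (hA : MeasurableSet A) {g X : ℝ} (hg : 0 ≤ g) (hX : 0 < X)
    (hmoment : moment V p T = ENNReal.ofReal X)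
    (h : g * energyIntegral V (Metric.thickening (2 * (1 / T)) A) (1 / T) ≤ X) :
    ((spectralMeasure V).real A ^ 2 * g / 96 / X) ^ p * ((spectralMeasure V).real A / 4) ≤ X := by
  set m := (spectralMeasure V).real A
  set I := energyIntegral V (Metric.thickening (2 * (1 / T)) A) (1 / T)
  set ν := m ^ 2 * g / (32 * X) with hν
  have hscale : m ^ 2 * g / 96 / X = ν / 3 := by rw [hν]; field_simp; ring
  rw [hscale]
  rcases le_or_gt 1 ν with hν₁ | hν₁
  · have hcorr : ν * correlationIntegral (spectralMeasure V) A (2 / T) ≤ m ^ 2 / 4 := by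
      calc ν * correlationIntegral (spectralMeasure V) A (2 / T) ≤ ν * (8 * I) := by
            gcongr
            exact correlationIntegral_spectralMeasure_le V hT hA
        _ = m ^ 2 / (4 * X) * (g * I) := by rw [hν]; field_simp; ring
        _ ≤ m ^ 2 / (4 * X) * X := by gcongr
        _ = m ^ 2 / 4 := by field_simp
    have hlower := le_moment_of_mul_correlationIntegral_le V hp hT hA hν₁ hcorr
    rwa [hmoment, ENNReal.ofReal_le_ofReal_iff hX.le] at hlower
  · have hconst := one_third_rpow_div_four_le_moment V hp hT
    rw [hmoment, ENNReal.ofReal_le_ofReal_iff hX.le] at hconst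
    have hm₁ : m ≤ 1 := measureReal_le_one
    calc (ν / 3) ^ p * (m / 4) ≤ (1 / 3) ^ p * (1 / 4) := by gcongr
      _ ≤ X := by linarith

theorem momentConst_mul_le_moment {p : ℝ} (hp : 0 < p) (hT : 0 < T) {A : Set ℝ}
    (hA : MeasurableSet A) {g : ℝ} (hg : 0 ≤ g)
    (h : ENNReal.ofReal (g * energyIntegral V (Metric.thickening (2 * (1 / T)) A) (1 / T)) ≤
      moment V p T) :
    ENNReal.ofReal (momentConst p * g ^ (p / (p + 1)) *
      (spectralMeasure V).real A ^ ((1 + 2 * p) / (p + 1))) ≤ moment V p T := by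
  by_cases htop : moment V p T = ⊤
  · rw [htop]
    exact le_top
  obtain ⟨X, hX₀, hmoment⟩ : ∃ X : ℝ, 0 ≤ X ∧ moment V p T = ENNReal.ofReal X :=
    ⟨_, ENNReal.toReal_nonneg, (ENNReal.ofReal_toReal htop).symm⟩
  have hconst := one_third_rpow_div_four_le_moment V hp hT
  rw [hmoment, ENNReal.ofReal_le_ofReal_iff hX₀] at hconst h ⊢
  have hX : 0 < X := lt_of_lt_of_le (by positivity) hconst
  rw [momentConst_mul_rpow_mul_rpow hp hg measureReal_nonneg]
  exact rpow_mul_rpow_le_of_div_rpow_mul_le hp (by positivity) (by positivity) hX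
    (div_rpow_mul_le_of_energyIntegral_le V hp hT hA hg hX hmoment h)

end Dynamics

end Schrodinger

theorem theorem2 (p : ℝ) (hp : 0 < p) :
    (∃ C : ℝ, 0 < C ∧ ∀ (d : Schrodinger.Domain) (V : d.sites → ℝ) (A : ℝ → Set ℝ) (g : ℝ → ℝ)
      (T : ℝ), 0 < T → MeasurableSet (A T) → 0 < Schrodinger.spectralMeasure V (A T) → 0 < g T →
      ENNReal.ofReal (g T * Schrodinger.energyIntegral V (Metric.thickening (2 * (1 / T)) (A T))
        (1 / T)) ≤ Schrodinger.moment V p T →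
      ENNReal.ofReal (C * g T ^ (p / (p + 1)) *
        (Schrodinger.spectralMeasure V).real (A T) ^ ((1 + 2 * p) / (p + 1))) ≤
          Schrodinger.moment V p T) ∧
    (∀ (d : Schrodinger.Domain) (V : d.sites → ℝ) (A : Set ℝ), MeasurableSet A →
      0 < Schrodinger.spectralMeasure V A →
      ∃ C : ℝ, 0 < C ∧ ∀ (g : ℝ → ℝ) (T : ℝ), 0 < T → 0 < g T →
        ENNReal.ofReal (g T * Schrodinger.energyIntegral V (Metric.thickening (2 * (1 / T)) A)
          (1 / T)) ≤ Schrodinger.moment V p T →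
        ENNReal.ofReal (C * g T ^ (p / (p + 1))) ≤ Schrodinger.moment V p T) := by
  refine ⟨⟨Schrodinger.momentConst p, Schrodinger.momentConst_pos p, ?_⟩, ?_⟩
  · intro d V A g T hT hA _ hg h
    exact Schrodinger.momentConst_mul_le_moment V hp hT hA hg.le h
  · intro d V A hA hμA
    have hm : 0 < (Schrodinger.spectralMeasure V).real A :=
      ENNReal.toReal_pos hμA.ne' (measure_ne_top _ _)
    refine ⟨Schrodinger.momentConst p *
      (Schrodinger.spectralMeasure V).real A ^ ((1 + 2 * p) / (p + 1)),
      mul_pos (Schrodinger.momentConst_pos p) (Real.rpow_pos_of_pos hm _), ?_⟩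
    intro g T hT hg h
    rw [mul_right_comm]
    exact Schrodinger.momentConst_mul_le_moment V hp hT hA hg.le h
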